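/- Let $d\ge 1$ be an integer and $\gamma>0$, and put $a=\tanh 2\gamma\in(0,1)$. For $f\in L^1(\mathbb R^d)$ let $\hat f(\xi)=(2\pi)^{-d/2}\int_{\mathbb R^d}e^{-i\xi\cdot x}f(x)\,dx$. The Hardy class $E^d_{\mathcal F}(a)$ consists of all complex-valued $f\in L^1(\mathbb R^d)\cap L^2(\mathbb R^d)$ for which there is a constant $C$ such that $$|f(x)|\le C e^{-a|x|^2/2}\ \text{ for a.e. } x\in\mathbb R^d,\qquad |\hat f(\xi)|\le C e^{-a|\xi|^2/2}\ \text{ for all } \xi\in\mathbb R^d. \qquad (*)$$ For $k\in\mathbb N_0$ let $h_k(x)=(-1)^k(2^k k!\sqrt\pi)^{-1/2}e^{x^2/2}\frac{d^k}{dx^k}e^{-x^2}$, and for $\alpha\in\mathbb N_0^d$ let $\mathbf h_\alpha(x)=\prod_{i=1}^d h_{\alpha_i}(x_i)$, $|\alpha|=\alpha_1+\dots+\alpha_d$ and $\langle f,\mathbf h_\alpha\rangle=\int_{\mathbb R^d}f(x)\mathbf h_\alpha(x)\,dx$. Theorem. There is a constant $K>0$ depending only on $\gamma$ and $d$ such that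 for every $f\in E^d_{\mathcal F}(\tanh 2\gamma)$, every $C$ for which $(*)$ holds with $a=\tanh 2\gamma$, and every $\alpha\in\mathbb N_0^d$ with $\alpha\neq 0$, $$|\langle f,\mathbf h_\alpha\rangle|\le K\,C\,d^{|\alpha|}\,|\alpha|^{\frac{d-2}{4}}\,e^{-\gamma|\alpha|}.$$ -/

import Mathlib

noncomputable section

/-- The Fourier transform on `ℝ^d` in the unitary normalisation,
`(2π)^{-d/2} ∫ e^{-i ξ·x} f(x) dx`. -/
def unitaryFourier (d : ℕ) (f : EuclideanSpace ℝ (Fin d) → ℂ) (ξ : EuclideanSpace ℝ (Fin d)) : ℂ :=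
  (((2 * Real.pi) ^ (-(d : ℝ) / 2) : ℝ) : ℂ) *
    ∫ x : EuclideanSpace ℝ (Fin d), Complex.exp (-(Complex.I * ((inner ℝ ξ x : ℝ) : ℂ))) * f x

/-- `f` and its Fourier transform are both dominated by `C e^{-a|x|²/2}`.  As `f` stands for its
almost-everywhere class, the bound on `f` is asked almost everywhere. -/
structure HardyBound (d : ℕ) (a C : ℝ) (f : EuclideanSpace ℝ (Fin d) → ℂ) : Prop where
  bound : ∀ᵐ x : EuclideanSpace ℝ (Fin d), ‖f x‖ ≤ C * Real.exp (-(a * ‖x‖ ^ 2 / 2))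
  fourier_bound : ∀ ξ : EuclideanSpace ℝ (Fin d),
    ‖unitaryFourier d f ξ‖ ≤ C * Real.exp (-(a * ‖ξ‖ ^ 2 / 2))

/-- The Hardy class `E_F^d(a)`. -/
def hardyClass (d : ℕ) (a : ℝ) : Set (EuclideanSpace ℝ (Fin d) → ℂ) :=
  {f | MeasureTheory.MemLp f 1 MeasureTheory.volume ∧
    MeasureTheory.MemLp f 2 MeasureTheory.volume ∧ ∃ C : ℝ, HardyBound d a C f}

/-- The Hermite function
`h_k(x) = (-1)^k (2^k k! √π)^{-1/2} e^{x²/2} (d/dx)^k e^{-x²}` on `ℝ`. -/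
def hermiteFun (k : ℕ) (x : ℝ) : ℝ :=
  (-1) ^ k * (Real.sqrt (2 ^ k * (Nat.factorial k : ℝ) * Real.sqrt Real.pi))⁻¹ *
    Real.exp (x ^ 2 / 2) * iteratedDeriv k (fun t : ℝ => Real.exp (-t ^ 2)) x

/-- The Hermite function `h_α(x) = ∏ h_{α_i}(x_i)` on `ℝ^d`. -/
def hermiteFunMulti {d : ℕ} (α : Fin d → ℕ) (x : EuclideanSpace ℝ (Fin d)) : ℝ :=
  ∏ i, hermiteFun (α i) (x i)

/-- The Hermite coefficient `⟨f, h_α⟩ = ∫ f(x) h_α(x) dx` (the `h_α` are real-valued). -/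
def hermiteCoeff {d : ℕ} (f : EuclideanSpace ℝ (Fin d) → ℂ) (α : Fin d → ℕ) : ℂ :=
  ∫ x : EuclideanSpace ℝ (Fin d), f x * ((hermiteFunMulti α x : ℝ) : ℂ)

end

open MeasureTheory Filter Topology Set

/-! The Bargmann transform `F(z) = ∫ f(x) ∏ exp(-xᵢ²/2 + √2 xᵢ zᵢ - zᵢ²/2) dx` turns `⟨f, h_α⟩` into
`π^{-d/4} √α!` times the Taylor coefficient of `F` at `z^α`, and the Fourier transform into the
rotation `z ↦ -iz`. With `q = (1-a)/(1+a) = e^{-4γ}`, the bound on `f` gives `|F(x+iy)| ≤ D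
exp((|y|² + q|x|²)/2)`, and the bound on its Fourier transform gives the same with `x` and `y`
exchanged.

On a complex line through a real unit vector, put `A = √q = e^{-2γ}` and `tan φ = A`.
Phragmén–Lindelöf in the sector `φ ≤ θ ≤ π/2 - φ` improves the two bounds to `exp(r² (A/2) sin 2θ)`
(`norm_le_of_sector`). Cauchy's formula on the circle `r² = k/A`, with Laplace's method for the
integral over the circle, bounds the `k`-th coefficient by a multiple of `e^{-γk} (e/k)^{k/2}
k^{-1/2}` (`norm_taylorCoeff_le_of_hardyGrowth`). By Stirling, multiplying by `√k!` leaves `k^{-1/4}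
e^{-γk}`.

For several variables, let `F_k` be the component of degree `k = |α|`. The above gives `|F_k(u)| ≤ M
|u|^k` for real `u`, and a half-plane Phragmén–Lindelöf argument (`norm_apply_I_le_add_pow`) extends
it to `|F_k(x+iy)| ≤ M (|x|+|y|)^k`. On the unit torus `|x|² + |y|² = d`, so this is at most `M
(2d)^{k/2} ≤ M d^k` when `d ≥ 2`. Cauchy's formula over the torus and `α! ≤ k!` conclude. -/

noncomputable section

/-! ### Cauchy's formula and holomorphic dependence on parameters -/

/-- The `k`-th Taylor coefficient at the origin. -/
def taylorCoeff (k : ℕ) (g : ℂ → ℂ) : ℂ := iteratedDeriv k g 0 / (k.factorial : ℂ)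

lemma taylorCoeff_comp_const_mul (k : ℕ) {g : ℂ → ℂ} (hg : Differentiable ℂ g) (c : ℂ) :
    taylorCoeff k (fun w => g (c * w)) = c ^ k * taylorCoeff k g := by
  unfold taylorCoeff
  rw [iteratedDeriv_comp_const_mul hg.contDiff c]
  simp [mul_div_assoc]

lemma taylorCoeff_eq_integral (k : ℕ) {g : ℂ → ℂ} (hg : Differentiable ℂ g) {ρ : ℝ} (hρ : 0 < ρ) :
    taylorCoeff k g = ((2 * Real.pi : ℝ) : ℂ)⁻¹ *
      ∫ θ in (0 : ℝ)..2 * Real.pi, ((circleMap 0 ρ θ) ^ k)⁻¹ * g (circleMap 0 ρ θ) := by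
  have h := (hg.differentiableOn (s := Metric.closedBall 0 ρ)).circleIntegral_one_div_sub_center_pow_smul
    hρ k
  have h2 : (∮ z in C(0, ρ), (1 / (z - 0) ^ (k + 1)) • g z) =
      Complex.I * ∫ θ in (0 : ℝ)..2 * Real.pi, ((circleMap 0 ρ θ) ^ k)⁻¹ * g (circleMap 0 ρ θ) := by
    rw [circleIntegral, ← intervalIntegral.integral_const_mul]
    congr 1
    ext θ
    have : circleMap 0 ρ θ ≠ 0 := circleMap_ne_center hρ.ne'
    simp only [deriv_circleMap, smul_eq_mul, sub_zero]
    field_simp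
    ring
  rw [h2] at h
  have hpi : (Real.pi : ℂ) ≠ 0 := by exact_mod_cast Real.pi_ne_zero
  have hk : (k.factorial : ℂ) ≠ 0 := by exact_mod_cast k.factorial_ne_zero
  unfold taylorCoeff
  rw [smul_eq_mul] at h
  have h3 : ∫ θ in (0 : ℝ)..2 * Real.pi, ((circleMap 0 ρ θ) ^ k)⁻¹ * g (circleMap 0 ρ θ) =
      2 * Real.pi / k.factorial * iteratedDeriv k g 0 := by
    apply mul_left_cancel₀ Complex.I_ne_zero
    rw [h]; ring
  rw [h3]
  push_cast
  field_simp

lemma norm_taylorCoeff_le_integral (k : ℕ) {g : ℂ → ℂ} (hg : Differentiable ℂ g) {ρ : ℝ}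
    (hρ : 0 < ρ) :
    ‖taylorCoeff k g‖ ≤ (2 * Real.pi)⁻¹ * (ρ ^ k)⁻¹ *
      ∫ θ in (0 : ℝ)..2 * Real.pi, ‖g (circleMap 0 ρ θ)‖ := by
  rw [taylorCoeff_eq_integral k hg hρ, norm_mul, norm_inv, Complex.norm_real,
    Real.norm_of_nonneg Real.two_pi_pos.le, mul_assoc]
  gcongr
  refine (intervalIntegral.norm_integral_le_integral_norm Real.two_pi_pos.le).trans_eq ?_
  rw [← intervalIntegral.integral_const_mul]
  congr 1
  ext θ
  simp [abs_of_pos hρ]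

lemma norm_taylorCoeff_le (k : ℕ) {g : ℂ → ℂ} (hg : Differentiable ℂ g) {B : ℝ}
    (hB : ∀ w : ℂ, ‖w‖ = 1 → ‖g w‖ ≤ B) : ‖taylorCoeff k g‖ ≤ B := by
  have h := Complex.norm_iteratedDeriv_le_of_forall_mem_sphere_norm_le k one_pos
    (hg.diffContOnCl (s := Metric.ball 0 1)) (C := B) (by simpa using hB)
  have hk : (0 : ℝ) < k.factorial := by exact_mod_cast k.factorial_pos
  simp only [one_pow, div_one] at h
  rw [taylorCoeff, norm_div, Complex.norm_natCast, div_le_iff₀ hk]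
  linarith

/-- The standard character of the unit circle, as a complex number of modulus one. -/
def unitChar (s : UnitAddCircle) : ℂ := (AddCircle.toCircle s : ℂ)

lemma norm_unitChar (s : UnitAddCircle) : ‖unitChar s‖ = 1 := Circle.norm_coe _

lemma unitChar_ne_zero (s : UnitAddCircle) : unitChar s ≠ 0 := Circle.coe_ne_zero _

lemma unitChar_add (s t : UnitAddCircle) : unitChar (s + t) = unitChar s * unitChar t := by
  simp [unitChar, AddCircle.toCircle_add]

@[fun_prop]
lemma continuous_unitChar : Continuous unitChar :=
  continuous_subtype_val.comp AddCircle.continuous_toCircle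

lemma unitChar_coe (x : ℝ) : unitChar (x : UnitAddCircle) = circleMap 0 1 (x * (2 * Real.pi)) := by
  rw [unitChar, AddCircle.toCircle_apply_mk, Circle.coe_exp, circleMap]
  simp
  ring_nf

lemma integral_unitChar_eq_taylorCoeff (k : ℕ) {g : ℂ → ℂ} (hg : Differentiable ℂ g) :
    ∫ s : UnitAddCircle, ((unitChar s) ^ k)⁻¹ * g (unitChar s) = taylorCoeff k g := by
  rw [← UnitAddCircle.intervalIntegral_preimage 0, taylorCoeff_eq_integral k hg one_pos]
  simp only [unitChar_coe, zero_add]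
  rw [intervalIntegral.integral_comp_mul_right
    (fun θ => ((circleMap 0 1 θ) ^ k)⁻¹ * g (circleMap 0 1 θ)) Real.two_pi_pos.ne']
  simp

/-- A parametric integral of entire functions, locally uniformly dominated, is entire. -/
lemma differentiable_integral_of_dominated {X : Type*} [MeasurableSpace X] {μ : Measure X}
    {F : ℂ → X → ℂ} (hF : ∀ x, Differentiable ℂ fun t => F t x)
    (hm : ∀ t, AEStronglyMeasurable (F t) μ)
    (hb : ∀ R : ℝ, ∃ b : X → ℝ, Integrable b μ ∧ ∀ x, ∀ t : ℂ, ‖t‖ ≤ R → ‖F t x‖ ≤ b x) :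
    Differentiable ℂ fun t => ∫ x, F t x ∂μ := by
  intro t₀
  -- The derivative is needed at points within `1` of `t₀`, and Cauchy's estimate there uses a unit
  -- circle; hence radius `‖t₀‖ + 2`, and one `b` for both the function and its derivative.
  obtain ⟨b, hbi, hb⟩ := hb (‖t₀‖ + 2)
  have hint : Integrable (F t₀) μ :=
    hbi.mono' (hm t₀) (Eventually.of_forall fun x => hb x t₀ (by linarith))
  refine (hasDerivAt_integral_of_dominated_loc_of_deriv_le (F := F)
    (F' := fun t x => deriv (fun t => F t x) t) (bound := b) (Metric.ball_mem_nhds t₀ one_pos)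
    (Eventually.of_forall hm) hint ?_ (Eventually.of_forall fun x t ht => ?_) hbi
    (Eventually.of_forall fun x t _ => (hF x t).hasDerivAt)).2.differentiableAt
  -- The derivative is measurable in `x` as a pointwise limit of difference quotients along a
  -- sequence.
  · have hlim : Tendsto (fun n : ℕ => t₀ + ((1 / ((n : ℝ) + 1) : ℝ) : ℂ)) atTop (𝓝[≠] t₀) := by
      rw [tendsto_nhdsWithin_iff]
      constructor
      · have := (Complex.continuous_ofReal.tendsto 0).comp
          (tendsto_one_div_add_atTop_nhds_zero_nat (𝕜 := ℝ))
        simpa using this.const_add t₀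
      · refine Eventually.of_forall fun n => ?_
        have : ((1 / ((n : ℝ) + 1) : ℝ) : ℂ) ≠ 0 := by
          exact_mod_cast (by positivity : (1 / ((n : ℝ) + 1) : ℝ) ≠ 0)
        simpa using this
    refine aestronglyMeasurable_of_tendsto_ae atTop
      (f := fun (n : ℕ) x => slope (fun t => F t x) t₀ (t₀ + ((1 / ((n : ℝ) + 1) : ℝ) : ℂ)))
      (fun n => ?_) (Eventually.of_forall fun x => ?_)
    · simp only [slope_def_field]
      exact (((hm _).sub (hm _)).mul_const _).congr (Eventually.of_forall fun x => rfl)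
    · exact (hasDerivAt_iff_tendsto_slope.1 (hF x t₀).hasDerivAt).comp hlim
  · have := Complex.norm_deriv_le_of_forall_mem_sphere_norm_le (c := t) one_pos
      ((hF x).diffContOnCl (s := Metric.ball t 1)) (C := b x) (fun z hz => hb x z ?_)
    · simpa using this
    · have h1 : ‖z - t‖ = 1 := by simpa [dist_eq_norm] using hz
      have h2 : ‖t - t₀‖ < 1 := by simpa [dist_eq_norm] using ht
      calc ‖z‖ = ‖(z - t) + (t - t₀) + t₀‖ := by congr 1; ring
        _ ≤ ‖z - t‖ + ‖t - t₀‖ + ‖t₀‖ := norm_add₃_le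
        _ ≤ ‖t₀‖ + 2 := by linarith

/-! ### Growth in a quadrant -/

/-- Phragmén–Lindelöf in the sector `φ ≤ arg z ≤ π/2 - φ` for functions of order two. -/
lemma norm_le_of_sector {g : ℂ → ℂ} (hg : Differentiable ℂ g) {D A φ : ℝ} (hD : 0 ≤ D)
    (hφ : 0 < φ) (hφ' : φ < Real.pi / 4)
    (hgrow : ∀ w : ℂ, ‖g w‖ ≤ D * Real.exp (‖w‖ ^ 2))
    (h₁ : ∀ r : ℝ, 0 < r → ‖g (circleMap 0 r φ)‖ ≤ D * Real.exp (r ^ 2 * (A / 2) * Real.sin (2 * φ)))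
    (h₂ : ∀ r : ℝ, 0 < r → ‖g (circleMap 0 r (Real.pi / 2 - φ))‖ ≤
      D * Real.exp (r ^ 2 * (A / 2) * Real.sin (2 * φ)))
    {r θ : ℝ} (hr : 0 < r) (hθ : φ ≤ θ) (hθ' : θ ≤ Real.pi / 2 - φ) :
    ‖g (circleMap 0 r θ)‖ ≤ D * Real.exp (r ^ 2 * (A / 2) * Real.sin (2 * θ)) := by
  -- With `w = exp ζ` the sector becomes a strip. The second factor has modulus `exp(-r² (A/2) sin
  -- 2θ)`, so the product is at most `D` on both edges.
  set h : ℂ → ℂ := fun ζ => g (Complex.exp ζ) *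
    Complex.exp (Complex.I * (A / 2 : ℝ) * Complex.exp (2 * ζ)) with hh
  have hdiff : Differentiable ℂ h := by
    have : Differentiable ℂ fun ζ => g (Complex.exp ζ) := hg.comp Complex.differentiable_exp
    fun_prop
  have hnorm2 : ∀ ζ : ℂ, ‖Complex.exp (Complex.I * (A / 2 : ℝ) * Complex.exp (2 * ζ))‖ =
      Real.exp (-((Real.exp ζ.re) ^ 2 * (A / 2) * Real.sin (2 * ζ.im))) := by
    intro ζ
    rw [Complex.norm_exp]
    congr 1
    have e1 : Complex.I * (A / 2 : ℝ) * Complex.exp (2 * ζ) =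
        ((A / 2 : ℝ) : ℂ) * (Complex.I * Complex.exp (2 * ζ)) := by ring
    rw [e1, Complex.re_ofReal_mul, Complex.I_mul_re, Complex.exp_im]
    have e2 : (2 * ζ).re = ζ.re + ζ.re := by simp; ring
    have e3 : (2 * ζ).im = 2 * ζ.im := by simp
    rw [e2, e3, Real.exp_add]
    ring
  have hexp : ∀ ζ : ℂ, Complex.exp ζ = circleMap 0 (Real.exp ζ.re) ζ.im := by
    intro ζ
    rw [circleMap, zero_add, Complex.ofReal_exp, ← Complex.exp_add, Complex.re_add_im]
  have hnorm : ∀ ζ : ℂ, ‖h ζ‖ = ‖g (circleMap 0 (Real.exp ζ.re) ζ.im)‖ *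
      Real.exp (-((Real.exp ζ.re) ^ 2 * (A / 2) * Real.sin (2 * ζ.im))) := by
    intro ζ
    rw [hh]
    simp only [norm_mul, hnorm2]
    rw [hexp ζ]
  have key : ∀ ζ : ℂ, φ ≤ ζ.im → ζ.im ≤ Real.pi / 2 - φ → ‖h ζ‖ ≤ D := by
    intro ζ hζ hζ'
    refine PhragmenLindelof.horizontal_strip (a := φ) (b := Real.pi / 2 - φ) (C := D)
      hdiff.diffContOnCl ?_ ?_ ?_ hζ hζ'
    -- Order `2` is admissible because the strip is narrower than `π/2`.
    · refine ⟨2, ?_, 1 + |A / 2|, ?_⟩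
      · rw [lt_div_iff₀ (by linarith)]
        linarith
      · refine Asymptotics.IsBigO.of_bound D (Eventually.of_forall fun z => ?_)
        have hz : (Real.exp z.re) ^ 2 ≤ Real.exp (2 * |z.re|) := by
          rw [← Real.exp_nat_mul]
          apply Real.exp_le_exp.2
          push_cast
          nlinarith [le_abs_self z.re]
        have hg' := hgrow (Complex.exp z)
        rw [Complex.norm_exp] at hg'
        rw [hh]
        simp only [norm_mul, hnorm2]
        rw [Real.norm_of_nonneg (Real.exp_pos _).le]
        calc _ ≤ D * Real.exp (Real.exp z.re ^ 2) * Real.exp (Real.exp z.re ^ 2 * |A / 2|) := by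
              gcongr
              have : -((A / 2) * Real.sin (2 * z.im)) ≤ |A / 2| := by
                refine (neg_le_abs _).trans ?_
                rw [abs_mul]
                exact mul_le_of_le_one_right (abs_nonneg _) (Real.abs_sin_le_one _)
              nlinarith [sq_nonneg (Real.exp z.re)]
          _ = D * Real.exp (Real.exp z.re ^ 2 * (1 + |A / 2|)) := by
              rw [mul_assoc, ← Real.exp_add]; ring_nf
          _ ≤ _ := by
              gcongr D * Real.exp ?_
              rw [mul_comm]
              gcongr
    · intro z hz
      rw [hnorm, hz, Real.exp_neg, ← div_eq_mul_inv, div_le_iff₀ (Real.exp_pos _)]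
      exact h₁ _ (Real.exp_pos _)
    · intro z hz
      rw [hnorm, hz, Real.exp_neg, ← div_eq_mul_inv, div_le_iff₀ (Real.exp_pos _)]
      have : Real.sin (2 * (Real.pi / 2 - φ)) = Real.sin (2 * φ) := by
        rw [show 2 * (Real.pi / 2 - φ) = Real.pi - 2 * φ by ring, Real.sin_pi_sub]
      rw [this]
      exact h₂ _ (Real.exp_pos _)
  have := key ⟨Real.log r, θ⟩ hθ hθ'
  rw [hnorm] at this
  simp only [Real.exp_log hr] at this
  rwa [Real.exp_neg, ← div_eq_mul_inv, div_le_iff₀ (Real.exp_pos _)] at this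

/-- The two Gaussian growth bounds satisfied by the Bargmann transform of a function in the
Hardy class, restricted to a complex line through a real direction. -/
structure HasHardyGrowth (q D : ℝ) (g : ℂ → ℂ) : Prop where
  bound_re : ∀ w : ℂ, ‖g w‖ ≤ D * Real.exp ((w.im ^ 2 + q * w.re ^ 2) / 2)
  bound_im : ∀ w : ℂ, ‖g w‖ ≤ D * Real.exp ((w.re ^ 2 + q * w.im ^ 2) / 2)

lemma HasHardyGrowth.nonneg {q D : ℝ} {g : ℂ → ℂ} (h : HasHardyGrowth q D g) : 0 ≤ D := by
  have := (norm_nonneg _).trans (h.bound_re 0)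
  simpa using this

/-- Multiplication by `i` exchanges the two bounds, so estimates on the first quadrant transfer to
the other three. -/
lemma HasHardyGrowth.comp_I_mul {q D : ℝ} {g : ℂ → ℂ} (h : HasHardyGrowth q D g) :
    HasHardyGrowth q D fun w => g (Complex.I * w) :=
  ⟨fun w => by simpa using h.bound_im (Complex.I * w),
    fun w => by simpa using h.bound_re (Complex.I * w)⟩

/-- The sharp indicator bound in the first quadrant, up to a fixed neighbourhood of the axes. -/
lemma HasHardyGrowth.norm_circleMap_le {A D φ : ℝ} {g : ℂ → ℂ} (hg : Differentiable ℂ g)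
    (h : HasHardyGrowth (A ^ 2) D g) (hA : 0 < A) (hA1 : A < 1)
    (hφ : 0 < φ) (hφ' : φ < Real.pi / 4)
    (hcos : Real.cos (2 * φ) = (1 - A ^ 2) / (1 + A ^ 2))
    (hsin : Real.sin (2 * φ) = 2 * A / (1 + A ^ 2))
    {r θ : ℝ} (hr : 0 < r) (hθ : 0 ≤ θ) (hθ' : θ ≤ Real.pi / 2) :
    ‖g (circleMap 0 r θ)‖ ≤ D * Real.exp (r ^ 2 * (A / 2) * max (Real.sin (2 * θ))
      (Real.sin (2 * φ))) := by
  have hD := h.nonneg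
  have hq : (0 : ℝ) < 1 + A ^ 2 := by positivity
  -- At `tan φ = A` the given exponent `(1+A²)/4 - (1-A²)/4 · cos 2θ` is tangent to the target
  -- `(A/2) sin 2θ`.
  have hmid : (1 + A ^ 2) / 4 - (1 - A ^ 2) / 4 * Real.cos (2 * φ) = A / 2 * Real.sin (2 * φ) := by
    rw [hcos, hsin]; field_simp; ring
  have hq1 : 0 ≤ (1 - A ^ 2) / 4 := by nlinarith
  have near : ∀ r θ : ℝ, 0 < r → 0 ≤ θ → θ ≤ φ →
      ‖g (circleMap 0 r θ)‖ ≤ D * Real.exp (r ^ 2 * (A / 2) * Real.sin (2 * φ)) := by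
    intro r θ hr h0 h1
    refine (h.bound_re _).trans ?_
    gcongr
    rw [circleMap_zero_re, circleMap_zero_im, mul_assoc, ← hmid]
    have hc : Real.cos (2 * φ) ≤ Real.cos (2 * θ) :=
      Real.cos_le_cos_of_nonneg_of_le_pi (by linarith) (by linarith) (by linarith)
    have : ((r * Real.sin θ) ^ 2 + A ^ 2 * (r * Real.cos θ) ^ 2) / 2 =
        r ^ 2 * ((1 + A ^ 2) / 4 - (1 - A ^ 2) / 4 * Real.cos (2 * θ)) := by
      rw [Real.cos_two_mul, mul_pow, mul_pow, Real.sin_sq]; ring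
    rw [this]
    gcongr
  have far : ∀ r θ : ℝ, 0 < r → Real.pi / 2 - φ ≤ θ → θ ≤ Real.pi / 2 →
      ‖g (circleMap 0 r θ)‖ ≤ D * Real.exp (r ^ 2 * (A / 2) * Real.sin (2 * φ)) := by
    intro r θ hr h0 h1
    refine (h.bound_im _).trans ?_
    gcongr
    rw [circleMap_zero_re, circleMap_zero_im, mul_assoc, ← hmid]
    have hc : Real.cos (2 * φ) ≤ Real.cos (2 * (Real.pi / 2 - θ)) :=
      Real.cos_le_cos_of_nonneg_of_le_pi (by linarith) (by linarith) (by linarith)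
    have : ((r * Real.cos θ) ^ 2 + A ^ 2 * (r * Real.sin θ) ^ 2) / 2 =
        r ^ 2 * ((1 + A ^ 2) / 4 - (1 - A ^ 2) / 4 * Real.cos (2 * (Real.pi / 2 - θ))) := by
      rw [Real.cos_two_mul, Real.cos_pi_div_two_sub, mul_pow, mul_pow, Real.cos_sq']; ring
    rw [this]
    gcongr
  rcases le_total θ φ with h1 | h1
  · refine (near r θ hr hθ h1).trans ?_
    gcongr
    exact le_max_right _ _
  rcases le_total (Real.pi / 2 - φ) θ with h2 | h2
  · refine (far r θ hr h2 hθ').trans ?_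
    gcongr
    exact le_max_right _ _
  · refine (norm_le_of_sector hg hD hφ hφ' (A := A) (fun w => ?_)
      (fun r hr => near r φ hr hφ.le le_rfl)
      (fun r hr => far r _ hr le_rfl (by linarith)) hr h1 h2).trans ?_
    · refine (h.bound_re w).trans ?_
      gcongr
      rw [Complex.sq_norm, Complex.normSq_apply]
      nlinarith [sq_nonneg w.re, sq_nonneg w.im, mul_nonneg hq1 (sq_nonneg w.re)]
    · gcongr
      exact le_max_left _ _

/-! ### Laplace's method and the coefficient bound in one variable -/

/-- A Laplace-type bound on a quarter circle. -/
lemma integral_exp_max_sin_le {σ l : ℝ} (hσ₀ : 0 ≤ σ) (hσ : σ < 1) (hl : 0 < l) :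
    ∫ θ in (0 : ℝ)..Real.pi / 2, Real.exp (l * max (Real.sin (2 * θ)) σ) ≤
      (Real.pi * √Real.pi + Real.pi / (1 - σ)) * (Real.exp l / √l) := by
  have hpi := Real.pi_pos
  have hs : 0 < 1 - σ := by linarith
  have hsl : 0 < √l := Real.sqrt_pos.2 hl
  -- From `cos x ≤ 1 - 2x²/π²` at `x = π/2 - 2θ`: the peak at `θ = π/4` lies below a Gaussian of
  -- width of order `1/√l`.
  set b : ℝ := l * (8 / Real.pi ^ 2) with hb
  have hb0 : 0 < b := by positivity
  have hint : Integrable (fun θ : ℝ => Real.exp (-b * (θ - Real.pi / 4) ^ 2)) :=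
    (integrable_exp_neg_mul_sq hb0).comp_sub_right (Real.pi / 4)
  have hgauss : ∫ θ : ℝ, Real.exp (-b * (θ - Real.pi / 4) ^ 2) = √(Real.pi / b) := by
    rw [integral_sub_right_eq_self (fun θ : ℝ => Real.exp (-b * θ ^ 2)) (Real.pi / 4),
      integral_gaussian]
  have hpt : ∀ θ ∈ Icc (0 : ℝ) (Real.pi / 2), Real.exp (l * max (Real.sin (2 * θ)) σ) ≤
      Real.exp l * Real.exp (-b * (θ - Real.pi / 4) ^ 2) + Real.exp (l * σ) := by
    intro θ hθ
    rcases max_cases (Real.sin (2 * θ)) σ with ⟨h, -⟩ | ⟨h, -⟩ <;> rw [h]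
    · refine le_add_of_le_of_nonneg ?_ (Real.exp_pos _).le
      rw [← Real.exp_add]
      apply Real.exp_le_exp.2
      have h1 := Real.cos_le_one_sub_mul_cos_sq (x := Real.pi / 2 - 2 * θ)
        (by rw [abs_le]; constructor <;> linarith [hθ.1, hθ.2])
      rw [Real.cos_pi_div_two_sub] at h1
      calc l * Real.sin (2 * θ) ≤ l * (1 - 2 / Real.pi ^ 2 * (Real.pi / 2 - 2 * θ) ^ 2) := by gcongr
        _ = _ := by rw [hb]; ring
    · exact le_add_of_nonneg_left (by positivity)
  have hle : (0 : ℝ) ≤ Real.pi / 2 := by positivity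
  calc ∫ θ in (0 : ℝ)..Real.pi / 2, Real.exp (l * max (Real.sin (2 * θ)) σ)
      ≤ ∫ θ in (0 : ℝ)..Real.pi / 2,
        (Real.exp l * Real.exp (-b * (θ - Real.pi / 4) ^ 2) + Real.exp (l * σ)) := by
        refine intervalIntegral.integral_mono_on hle ?_ ?_ hpt <;>
          exact Continuous.intervalIntegrable (by fun_prop) _ _
    _ = Real.exp l * (∫ θ in (0 : ℝ)..Real.pi / 2, Real.exp (-b * (θ - Real.pi / 4) ^ 2)) +
        Real.pi / 2 * Real.exp (l * σ) := by
        rw [intervalIntegral.integral_add, intervalIntegral.integral_const_mul] <;>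
          first | exact Continuous.intervalIntegrable (by fun_prop) _ _ | simp
    _ ≤ Real.exp l * √(Real.pi / b) + Real.pi / 2 * Real.exp (l * σ) := by
        gcongr
        rw [intervalIntegral.integral_of_le hle, ← hgauss]
        exact setIntegral_le_integral hint (Eventually.of_forall fun _ => (Real.exp_pos _).le)
    _ ≤ Real.exp l * (Real.pi * √Real.pi / √l) +
        Real.pi / 2 * (Real.exp l * (2 / (1 - σ) / √l)) := by
        gcongr
        · rw [le_div_iff₀ hsl, ← Real.sqrt_mul (by positivity)]
          rw [show Real.pi / b * l = Real.pi ^ 2 * Real.pi / 8 by rw [hb]; field_simp]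
          rw [← Real.sqrt_sq hpi.le, ← Real.sqrt_mul (by positivity), Real.sqrt_sq hpi.le]
          apply Real.sqrt_le_sqrt
          have : 0 < Real.pi ^ 2 * Real.pi := by positivity
          linarith
        -- The part away from the peak is smaller: `exp(-l(1-σ)) ≤ 2 / ((1-σ)√l)`.
        · rw [show l * σ = l - l * (1 - σ) by ring, Real.exp_sub, div_eq_mul_inv]
          gcongr
          rw [inv_le_comm₀ (Real.exp_pos _) (by positivity), inv_div, div_div_eq_mul_div]
          have h1 := Real.add_one_le_exp (l * (1 - σ))
          have h2 : √l ≤ 1 + l := by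
            rw [Real.sqrt_le_left (by positivity)]; nlinarith
          refine le_trans ?_ h1
          have h3 := mul_le_mul_of_nonneg_right h2 hs.le
          have h4 : 0 ≤ √l * (1 - σ) := by positivity
          rw [div_le_iff₀ two_pos]
          nlinarith
    _ = _ := by field_simp


/-- Integrating a bound on the first quadrant over `n` consecutive quadrants. -/
lemma integral_norm_circleMap_le {P : (ℂ → ℂ) → Prop}
    (hP : ∀ g, P g → P fun w => g (Complex.I * w)) (hc : ∀ g, P g → Continuous g) {ρ Q : ℝ}
    (hQ : ∀ g, P g → ∫ θ in (0 : ℝ)..Real.pi / 2, ‖g (circleMap 0 ρ θ)‖ ≤ Q) (n : ℕ) :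
    ∀ g, P g → ∫ θ in (0 : ℝ)..n * (Real.pi / 2), ‖g (circleMap 0 ρ θ)‖ ≤ n * Q := by
  have hci : ∀ g, P g → Continuous fun θ => ‖g (circleMap 0 ρ θ)‖ := fun g hg =>
    ((hc g hg).comp (continuous_circleMap 0 ρ)).norm
  induction n with
  | zero => intro g _; simp
  | succ n ih =>
    intro g hg
    rw [← intervalIntegral.integral_add_adjacent_intervals (b := Real.pi / 2)
      ((hci g hg).intervalIntegrable _ _) ((hci g hg).intervalIntegrable _ _)]
    have h1 := hQ g hg
    -- The last `n` quadrants for `g` are the first `n` for `w ↦ g (i w)`.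
    have h2 := ih _ (hP g hg)
    have h3 : ∫ θ in (0 : ℝ)..n * (Real.pi / 2), ‖g (Complex.I * circleMap 0 ρ θ)‖ =
        ∫ θ in Real.pi / 2..((n + 1 : ℕ) : ℝ) * (Real.pi / 2), ‖g (circleMap 0 ρ θ)‖ := by
      have h4 : ∀ θ : ℝ, Complex.I * circleMap 0 ρ θ = circleMap 0 ρ (θ + Real.pi / 2) := by
        intro θ
        rw [circleMap, circleMap]
        push_cast
        rw [add_mul, Complex.exp_add, Complex.exp_pi_div_two_mul_I]
        ring
      simp only [h4]
      rw [intervalIntegral.integral_comp_add_right (fun θ => ‖g (circleMap 0 ρ θ)‖)]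
      push_cast
      ring_nf
    rw [← h3]
    push_cast
    linarith

/-- Taylor coefficients of an entire function with the two Gaussian growth bounds. -/
lemma norm_taylorCoeff_le_of_hardyGrowth {B : ℝ} (hB : 0 < B) (hB1 : B < 1) :
    ∃ K : ℝ, 0 < K ∧ ∀ (D : ℝ) (g : ℂ → ℂ), Differentiable ℂ g →
      HasHardyGrowth ((B ^ 2) ^ 2) D g → ∀ k : ℕ, k ≠ 0 → ‖taylorCoeff k g‖ ≤
        K * D * (B ^ k * Real.exp (k / 2) / (√k ^ k * √k)) := by
  set A := B ^ 2 with hAdef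
  have hA : 0 < A := by positivity
  have hA1 : A < 1 := by rw [hAdef]; nlinarith
  set φ := Real.arctan A with hφdef
  have hφ : 0 < φ := Real.arctan_pos.2 hA
  have hφ' : φ < Real.pi / 4 := by
    rw [← Real.arctan_one]; exact Real.arctan_strictMono hA1
  have hq : (0 : ℝ) < 1 + A ^ 2 := by positivity
  have hcos : Real.cos (2 * φ) = (1 - A ^ 2) / (1 + A ^ 2) := by
    rw [Real.cos_two_mul, Real.cos_sq_arctan]; field_simp; ring
  have hsin : Real.sin (2 * φ) = 2 * A / (1 + A ^ 2) := by
    rw [Real.sin_two_mul, Real.sin_arctan, Real.cos_arctan]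
    have := Real.mul_self_sqrt hq.le
    field_simp
    rw [Real.sq_sqrt hq.le]
  have hσ₀ : 0 ≤ Real.sin (2 * φ) := by rw [hsin]; positivity
  have hσ : Real.sin (2 * φ) < 1 := by
    rw [hsin, div_lt_one hq]; nlinarith [sq_nonneg (1 - A), sq_pos_of_pos (sub_pos.2 hA1)]
  set c : ℝ := Real.pi * √Real.pi + Real.pi / (1 - Real.sin (2 * φ)) with hcdef
  have hc : 0 < c := by
    have : 0 < 1 - Real.sin (2 * φ) := by linarith
    have := Real.pi_pos
    positivity
  refine ⟨(2 * Real.pi)⁻¹ * 4 * c * √2, by positivity, fun D g hg hH k hk => ?_⟩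
  have hk0 : (0 : ℝ) < k := by exact_mod_cast Nat.pos_of_ne_zero hk
  have hsk : 0 < √(k : ℝ) := Real.sqrt_pos.2 hk0
  -- This radius minimises `ρ^{-k} exp(ρ² A/2)`.
  have hρ : 0 < √k / B := by positivity
  have hl : (√k / B) ^ 2 * (A / 2) = k / 2 := by
    rw [hAdef, div_pow, Real.sq_sqrt hk0.le]; field_simp
  have hquarter : ∀ g : ℂ → ℂ, Differentiable ℂ g ∧ HasHardyGrowth (A ^ 2) D g →
      ∫ θ in (0 : ℝ)..Real.pi / 2, ‖g (circleMap 0 (√k / B) θ)‖ ≤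
        D * (c * (Real.exp (k / 2) / √(k / 2))) := by
    rintro g ⟨hg, hH⟩
    refine le_trans ?_ (mul_le_mul_of_nonneg_left
      (integral_exp_max_sin_le hσ₀ hσ (half_pos hk0)) hH.nonneg)
    rw [← intervalIntegral.integral_const_mul]
    refine intervalIntegral.integral_mono_on (by positivity) ?_ ?_ fun θ hθ => ?_
    · exact ((hg.continuous.comp (continuous_circleMap 0 _)).norm).intervalIntegrable _ _
    · exact Continuous.intervalIntegrable (by fun_prop) _ _
    · rw [← hl]
      exact hH.norm_circleMap_le hg hA hA1 hφ hφ' hcos hsin hρ hθ.1 hθ.2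
  have hfull := integral_norm_circleMap_le (P := fun g => Differentiable ℂ g ∧
    HasHardyGrowth (A ^ 2) D g)
    (fun g h => ⟨h.1.comp (differentiable_id.const_mul _), h.2.comp_I_mul⟩)
    (fun g h => h.1.continuous) hquarter 4 g ⟨hg, hH⟩
  rw [show ((4 : ℕ) : ℝ) * (Real.pi / 2) = 2 * Real.pi by push_cast; ring] at hfull
  refine (norm_taylorCoeff_le_integral k hg hρ).trans
    ((mul_le_mul_of_nonneg_left hfull (by positivity)).trans_eq ?_)
  rw [Real.sqrt_div hk0.le, div_pow]
  push_cast
  field_simp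

/-! ### From real to complex directions -/

/-- An entire function dominated on the real line by the `k`-th power of
`|x + t y| = √(X² + 2tm + t²Y²)`, and of polynomial growth, is at most `M (X + Y)^k` at `i`. -/
lemma norm_apply_I_le_add_pow {p : ℂ → ℂ} (hp : Differentiable ℂ p) {X Y m M B : ℝ} {k : ℕ}
    (hX : 0 ≤ X) (hY : 0 ≤ Y) (hm : |m| ≤ X * Y) (hM : 0 ≤ M) (hB : 0 ≤ B)
    (hreal : ∀ t : ℝ, ‖p t‖ ≤ M * √(X ^ 2 + 2 * t * m + t ^ 2 * Y ^ 2) ^ k)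
    (hgrow : ∀ t : ℂ, ‖p t‖ ≤ B * (X + ‖t‖ * Y) ^ k) :
    ‖p Complex.I‖ ≤ M * (X + Y) ^ k := by
  -- The quadratic is `|Yt + β + iδ|²` on the real line. If `Y = 0`, division by zero gives `β = 0`,
  -- which is consistent since then `m = 0`.
  set β := m / Y with hβ
  have hβX : |β| ≤ X := by
    rw [hβ, abs_div, abs_of_nonneg hY]
    exact div_le_of_le_mul₀ hY hX hm
  have hmβ : m = β * Y := by
    rcases hY.eq_or_lt with h | h
    · rw [← h] at hm ⊢
      simpa using hm
    · rw [hβ]; field_simp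
  have hβX2 : β ^ 2 ≤ X ^ 2 := by
    rw [← sq_abs]; gcongr
  set δ := √(X ^ 2 - β ^ 2) with hδ
  have hδ0 : 0 ≤ δ := Real.sqrt_nonneg _
  have hδ2 : δ ^ 2 = X ^ 2 - β ^ 2 := Real.sq_sqrt (by linarith)
  have hδX : δ ≤ X := by
    rw [hδ, Real.sqrt_le_left hX]
    nlinarith [sq_nonneg β]
  have key : ∀ ε : ℝ, 0 < ε → ‖p Complex.I‖ ≤ M * (X + Y + ε) ^ k := by
    intro ε hε
    -- This linear factor dominates the square root on the real line and has no zero in the closed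
    -- upper half-plane; `ε` covers `δ = 0`.
    set l : ℂ → ℂ := fun t => Y * t + β + Complex.I * ((δ + ε : ℝ) : ℂ) with hl
    have hlre : ∀ t, (l t).re = Y * t.re + β := fun t => by simp [hl]
    have hlim : ∀ t, (l t).im = Y * t.im + (δ + ε) := fun t => by simp [hl]
    have hlow : ∀ t : ℂ, 0 ≤ t.im → ε ≤ ‖l t‖ := by
      intro t ht
      refine le_trans ?_ ((le_abs_self _).trans (Complex.abs_im_le_norm (l t)))
      rw [hlim]
      have := mul_nonneg hY ht
      linarith
    have hne : ∀ t : ℂ, 0 ≤ t.im → l t ≠ 0 := fun t ht h0 => by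
      have := hlow t ht
      rw [h0, norm_zero] at this
      linarith
    set c : ℝ := X / ε + (1 + (|β| + (δ + ε)) / ε) with hcdef
    have hc : 0 ≤ c := by positivity
    have hup : ∀ t : ℂ, 0 ≤ t.im → X + ‖t‖ * Y ≤ c * ‖l t‖ := by
      intro t ht
      have h1 := hlow t ht
      have h2 : ‖t‖ * Y ≤ ‖l t‖ + (|β| + (δ + ε)) := by
        have : (Y : ℂ) * t = l t - (β + Complex.I * ((δ + ε : ℝ) : ℂ)) := by rw [hl]; ring
        calc ‖t‖ * Y = ‖(Y : ℂ) * t‖ := by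
              rw [norm_mul, Complex.norm_real, Real.norm_of_nonneg hY, mul_comm]
          _ ≤ ‖l t‖ + ‖(β : ℂ) + Complex.I * ((δ + ε : ℝ) : ℂ)‖ := by
              rw [this]; exact norm_sub_le _ _
          _ ≤ _ := by
              gcongr
              refine (norm_add_le _ _).trans ?_
              rw [norm_mul, Complex.norm_I, one_mul, Complex.norm_real, Complex.norm_real,
                Real.norm_eq_abs, Real.norm_of_nonneg (by positivity : 0 ≤ δ + ε)]
      have h3 : ∀ v : ℝ, 0 ≤ v → v ≤ v / ε * ‖l t‖ := by
        intro v hv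
        rw [div_mul_eq_mul_div, le_div_iff₀ hε]
        gcongr
      have h4 := h3 X hX
      have h5 := h3 (|β| + (δ + ε)) (by positivity)
      rw [hcdef]
      linarith
    -- The map `s ↦ is` carries the right half-plane to the upper one and `1` to `i`. There `p /
    -- l^k` is bounded, and at most `M` on the boundary.
    set Q : ℂ → ℂ := fun s => p (Complex.I * s) / l (Complex.I * s) ^ k with hQ
    have him : ∀ s : ℂ, (Complex.I * s).im = s.re := fun s => by simp
    have hQb : ∀ s : ℂ, 0 ≤ s.re → ‖Q s‖ ≤ B * c ^ k := by
      intro s hs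
      have h0 : 0 ≤ (Complex.I * s).im := by rwa [him]
      have h1 : 0 < ‖l (Complex.I * s)‖ := norm_pos_iff.2 (hne _ h0)
      rw [hQ]
      simp only [norm_div, norm_pow]
      rw [div_le_iff₀ (by positivity), mul_assoc, ← mul_pow]
      refine (hgrow _).trans ?_
      gcongr
      exact hup _ h0
    have hldiff : Differentiable ℂ l := by
      rw [hl]; fun_prop
    have hfin := PhragmenLindelof.right_half_plane_of_bounded_on_real (f := Q) (C := M)
      (z := 1) ?_ ?_ ?_ ?_ (by simp)
    · rw [hQ] at hfin
      simp only [mul_one, norm_div, norm_pow] at hfin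
      have h0 : (0 : ℝ) ≤ (Complex.I).im := by simp
      have h1 : 0 < ‖l Complex.I‖ := norm_pos_iff.2 (hne _ h0)
      rw [div_le_iff₀ (by positivity)] at hfin
      refine hfin.trans ?_
      gcongr
      -- Uses `β² + (δ+Y)² = X² + 2δY + Y² ≤ (X+Y)²`.
      have h2 : l Complex.I = (β + Complex.I * ((δ + Y : ℝ) : ℂ)) + Complex.I * (ε : ℂ) := by
        rw [hl]; push_cast; ring
      rw [h2]
      refine (norm_add_le _ _).trans ?_
      gcongr
      · rw [Complex.norm_eq_sqrt_sq_add_sq, Real.sqrt_le_left (by positivity)]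
        simp
        nlinarith
      · rw [norm_mul, Complex.norm_I, one_mul, Complex.norm_real, Real.norm_of_nonneg hε.le]
    · refine DifferentiableOn.diffContOnCl ?_
      intro s hs
      have hs' : 0 ≤ s.re := by
        have : closure {z : ℂ | 0 < z.re} ⊆ {z : ℂ | 0 ≤ z.re} :=
          closure_minimal (fun z (hz : 0 < z.re) => show 0 ≤ z.re from hz.le) (isClosed_le continuous_const Complex.continuous_re)
        exact this hs
      have h1 : DifferentiableAt ℂ (fun s => p (Complex.I * s)) s :=
        (hp.comp (differentiable_id.const_mul _)) s
      have h2 : DifferentiableAt ℂ (fun s => l (Complex.I * s)) s :=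
        (hldiff.comp (differentiable_id.const_mul _)) s
      exact (h1.div (h2.pow k) (pow_ne_zero _ (hne _ (by rwa [him])))).differentiableWithinAt
    · refine ⟨0, by norm_num, 0, Asymptotics.IsBigO.of_bound (B * c ^ k) ?_⟩
      rw [eventually_inf_principal]
      refine Eventually.of_forall fun s hs => ?_
      simpa using hQb s (le_of_lt hs)
    · refine ⟨B * c ^ k, ?_⟩
      rw [eventually_map]
      filter_upwards [eventually_ge_atTop 0] with x hx
      exact hQb _ (by simpa using hx)
    · intro x
      have hx : Complex.I * (x * Complex.I) = ((-x : ℝ) : ℂ) := by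
        push_cast
        rw [mul_comm, mul_assoc, Complex.I_mul_I]; ring
      have h0 : (0 : ℝ) ≤ (((-x : ℝ) : ℂ)).im := by simp
      have h1 : 0 < ‖l ((-x : ℝ) : ℂ)‖ := norm_pos_iff.2 (hne _ h0)
      rw [hQ]
      simp only [hx, norm_div, norm_pow]
      rw [div_le_iff₀ (by positivity)]
      refine (hreal _).trans ?_
      gcongr
      rw [Complex.norm_eq_sqrt_sq_add_sq]
      apply Real.sqrt_le_sqrt
      rw [hlre, hlim, hmβ]
      simp only [Complex.ofReal_re, Complex.ofReal_im]
      nlinarith [mul_nonneg hδ0 hε.le, sq_nonneg ε]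
  have hlim : Tendsto (fun ε : ℝ => M * (X + Y + ε) ^ k) (𝓝[>] 0) (𝓝 (M * (X + Y + 0) ^ k)) :=
    (Continuous.tendsto (by fun_prop) 0).mono_left nhdsWithin_le_nhds
  rw [add_zero] at hlim
  exact ge_of_tendsto hlim (by filter_upwards [self_mem_nhdsWithin] with ε hε using key ε hε)

/-! ### The Bargmann kernel -/

/-- The one-dimensional Bargmann kernel `exp(-x²/2 + √2 x z - z²/2)`. -/
def bargmannKernel (x : ℝ) (z : ℂ) : ℂ :=
  Complex.exp (-(x : ℂ) ^ 2 / 2 + (√2 : ℝ) * x * z - z ^ 2 / 2)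

@[fun_prop]
lemma Continuous.bargmannKernel {X : Type*} [TopologicalSpace X] {u : X → ℝ} {v : X → ℂ}
    (hu : Continuous u) (hv : Continuous v) : Continuous fun t => bargmannKernel (u t) (v t) := by
  unfold _root_.bargmannKernel; fun_prop

lemma differentiable_bargmannKernel (x : ℝ) : Differentiable ℂ (bargmannKernel x) := by
  unfold bargmannKernel; fun_prop

lemma norm_bargmannKernel (x : ℝ) (z : ℂ) :
    ‖bargmannKernel x z‖ = Real.exp (-x ^ 2 / 2 + √2 * x * z.re - (z.re ^ 2 - z.im ^ 2) / 2) := by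
  rw [bargmannKernel, Complex.norm_exp]
  congr 1
  have e1 : -(x : ℂ) ^ 2 / 2 + (√2 : ℝ) * x * z - z ^ 2 / 2 =
    ((-x ^ 2 / 2 : ℝ) : ℂ) + ((√2 * x : ℝ) : ℂ) * z - ((1 / 2 : ℝ) : ℂ) * (z * z) := by
    push_cast; ring
  rw [e1, Complex.sub_re, Complex.add_re, Complex.re_ofReal_mul, Complex.re_ofReal_mul,
    Complex.mul_re, Complex.ofReal_re]
  ring

/-- Completing the square in `x` gives a bound uniform in `x`, so integrability of `f` alone
controls the transform locally uniformly. -/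
lemma norm_bargmannKernel_le (x : ℝ) (z : ℂ) : ‖bargmannKernel x z‖ ≤ Real.exp (‖z‖ ^ 2 / 2) := by
  rw [norm_bargmannKernel, Complex.sq_norm, Complex.normSq_apply]
  apply Real.exp_le_exp.2
  have h2 : √2 ^ 2 = (2 : ℝ) := Real.sq_sqrt (by norm_num)
  nlinarith [sq_nonneg (x - √2 * z.re)]

lemma integral_exp_quadratic {b : ℝ} (hb : 0 < b) (c d : ℝ) :
    ∫ x : ℝ, Real.exp (-b * x ^ 2 + c * x + d) = √(Real.pi / b) * Real.exp (c ^ 2 / (4 * b) + d) := by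
  have h : ∀ x : ℝ, Real.exp (-b * x ^ 2 + c * x + d) =
      Real.exp (-b * (x - c / (2 * b)) ^ 2) * Real.exp (c ^ 2 / (4 * b) + d) := by
    intro x
    rw [← Real.exp_add]
    congr 1
    field_simp
    ring
  simp only [h]
  rw [integral_mul_const, integral_sub_right_eq_self (fun x : ℝ => Real.exp (-b * x ^ 2)),
    integral_gaussian]

lemma integrable_exp_quadratic {b : ℝ} (hb : 0 < b) (c d : ℝ) :
    Integrable fun x : ℝ => Real.exp (-b * x ^ 2 + c * x + d) := by
  -- Without integrability the integral would be `0` by convention, contradicting its positive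
  -- value.
  by_contra H
  have := integral_exp_quadratic hb c d
  rw [integral_undef H] at this
  have : 0 < √(Real.pi / b) * Real.exp (c ^ 2 / (4 * b) + d) := by
    have := Real.pi_pos; positivity
  linarith

lemma gaussian_mul_norm_bargmannKernel (a : ℝ) (z : ℂ) (x : ℝ) :
    Real.exp (-(a * x ^ 2 / 2)) * ‖bargmannKernel x z‖ =
      Real.exp (-((1 + a) / 2) * x ^ 2 + (√2 * z.re) * x + -((z.re ^ 2 - z.im ^ 2) / 2)) := by
  rw [norm_bargmannKernel, ← Real.exp_add]
  congr 1
  ring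

lemma integrable_gaussian_mul_norm_bargmannKernel {a : ℝ} (ha : -1 < a) (z : ℂ) :
    Integrable fun x : ℝ => Real.exp (-(a * x ^ 2 / 2)) * ‖bargmannKernel x z‖ := by
  simp only [gaussian_mul_norm_bargmannKernel]
  exact integrable_exp_quadratic (by linarith) _ _

/-- Completing the square produces `q`, through `1/(1+a) - 1/2 = q/2`. -/
lemma integral_gaussian_mul_norm_bargmannKernel {a q : ℝ} (ha : -1 < a)
    (hq : q * (1 + a) = 1 - a) (z : ℂ) :
    ∫ x : ℝ, Real.exp (-(a * x ^ 2 / 2)) * ‖bargmannKernel x z‖ =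
      √(2 * Real.pi / (1 + a)) * Real.exp ((z.im ^ 2 + q * z.re ^ 2) / 2) := by
  simp only [gaussian_mul_norm_bargmannKernel]
  have h1 : 0 < 1 + a := by linarith
  rw [integral_exp_quadratic (by linarith)]
  have h2 : √2 ^ 2 = (2 : ℝ) := Real.sq_sqrt (by norm_num)
  congr 2
  · field_simp
  · rw [mul_pow, h2, eq_div_of_mul_eq h1.ne' hq]
    field_simp
    ring

lemma integrable_bargmannKernel (z : ℂ) : Integrable fun x : ℝ => bargmannKernel x z := by
  have h := integrable_gaussian_mul_norm_bargmannKernel (a := 0) (by norm_num) z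
  simp only [zero_mul, zero_div, neg_zero, Real.exp_zero, one_mul] at h
  exact (integrable_norm_iff (Continuous.aestronglyMeasurable (by fun_prop))).1 h

/-- The one-dimensional source of the rotation `z ↦ -iz`. -/
lemma integral_fourier_bargmannKernel (x : ℝ) (z : ℂ) :
    ∫ ξ : ℝ, Complex.exp (-(Complex.I * ((ξ * x : ℝ) : ℂ))) * bargmannKernel ξ z =
      (√(2 * Real.pi) : ℝ) * bargmannKernel x (-Complex.I * z) := by
  have h2 : ((√2 : ℝ) : ℂ) ^ 2 = 2 := by
    rw [← Complex.ofReal_pow, Real.sq_sqrt (by norm_num)]; norm_num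
  have h : ∀ ξ : ℝ, Complex.exp (-(Complex.I * ((ξ * x : ℝ) : ℂ))) * bargmannKernel ξ z =
      Complex.exp ((-1 / 2 : ℂ) * ξ ^ 2 + ((√2 : ℝ) * z - Complex.I * x) * ξ + (-z ^ 2 / 2)) := by
    intro ξ
    rw [bargmannKernel, ← Complex.exp_add]
    congr 1
    push_cast
    ring
  simp only [h]
  rw [integral_cexp_quadratic (by norm_num), bargmannKernel]
  congr 1
  · rw [show (Real.pi : ℂ) / -(-1 / 2) = ((2 * Real.pi : ℝ) : ℂ) by push_cast; ring,
      Real.sqrt_eq_rpow, Complex.ofReal_cpow Real.two_pi_pos.le]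
    norm_num
  · congr 1
    ring_nf
    rw [h2, Complex.I_sq]
    ring

/-! ### Products over the coordinates of `ℝ^d` -/

lemma integral_euclideanSpace_prod {𝕜 : Type*} [RCLike 𝕜] {d : ℕ} (φ : Fin d → ℝ → 𝕜) :
    ∫ x : EuclideanSpace ℝ (Fin d), ∏ i, φ i (x i) = ∏ i, ∫ t, φ i t := by
  rw [← (PiLp.volume_preserving_toLp (Fin d)).integral_comp
    (MeasurableEquiv.toLp 2 _).measurableEmbedding]
  exact integral_fintype_prod_volume_eq_prod _

lemma integrable_euclideanSpace_prod {𝕜 : Type*} [RCLike 𝕜] {d : ℕ} {φ : Fin d → ℝ → 𝕜}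
    (h : ∀ i, Integrable (φ i)) :
    Integrable fun x : EuclideanSpace ℝ (Fin d) => ∏ i, φ i (x i) := by
  rw [← (PiLp.volume_preserving_toLp (Fin d)).integrable_comp_emb
    (MeasurableEquiv.toLp 2 _).measurableEmbedding]
  exact Integrable.fintype_prod h

/-! ### The Bargmann transform on `ℝ^d` -/

/-- The Bargmann kernel on `ℝ^d × ℂ^d`. -/
def bargmannKernelMulti {d : ℕ} (x : EuclideanSpace ℝ (Fin d)) (z : Fin d → ℂ) : ℂ :=
  ∏ i, bargmannKernel (x i) (z i)

@[fun_prop]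
lemma Continuous.bargmannKernelMulti {d : ℕ} {X : Type*} [TopologicalSpace X]
    {u : X → EuclideanSpace ℝ (Fin d)} {v : X → Fin d → ℂ} (hu : Continuous u) (hv : Continuous v) :
    Continuous fun t => bargmannKernelMulti (u t) (v t) := by
  unfold _root_.bargmannKernelMulti; fun_prop

lemma norm_bargmannKernelMulti_le {d : ℕ} (x : EuclideanSpace ℝ (Fin d)) {z : Fin d → ℂ} {R : ℝ}
    (hz : ‖z‖ ≤ R) : ‖bargmannKernelMulti x z‖ ≤ Real.exp (d * (R ^ 2 / 2)) := by
  rw [bargmannKernelMulti, norm_prod]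
  calc ∏ i, ‖bargmannKernel (x i) (z i)‖ ≤ ∏ _i : Fin d, Real.exp (R ^ 2 / 2) := by
        gcongr with i
        refine (norm_bargmannKernel_le _ _).trans ?_
        gcongr
        exact (norm_le_pi_norm z i).trans hz
    _ = _ := by simp [← Real.exp_nat_mul]

/-- The Bargmann transform, up to normalisation. -/
def bargmann {d : ℕ} (f : EuclideanSpace ℝ (Fin d) → ℂ) (z : Fin d → ℂ) : ℂ :=
  ∫ x, f x * bargmannKernelMulti x z

lemma gaussian_mul_norm_bargmannKernelMulti {d : ℕ} (a : ℝ) (z : Fin d → ℂ)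
    (x : EuclideanSpace ℝ (Fin d)) :
    Real.exp (-(a * ‖x‖ ^ 2 / 2)) * ‖bargmannKernelMulti x z‖ =
      ∏ i, (Real.exp (-(a * x i ^ 2 / 2)) * ‖bargmannKernel (x i) (z i)‖) := by
  rw [bargmannKernelMulti, norm_prod, Finset.prod_mul_distrib, ← Real.exp_sum,
    EuclideanSpace.real_norm_sq_eq, Finset.sum_neg_distrib, ← Finset.sum_div, ← Finset.mul_sum]

/-- Stated for a general `h` so as to serve both `f` and its Fourier transform. -/
lemma norm_bargmann_le {d : ℕ} {h : EuclideanSpace ℝ (Fin d) → ℂ} {a q C : ℝ} (ha : -1 < a)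
    (hq : q * (1 + a) = 1 - a) (hh : ∀ᵐ x, ‖h x‖ ≤ C * Real.exp (-(a * ‖x‖ ^ 2 / 2)))
    (z : Fin d → ℂ) :
    ‖bargmann h z‖ ≤ C * √(2 * Real.pi / (1 + a)) ^ d *
      Real.exp ((∑ i, (z i).im ^ 2 + q * ∑ i, (z i).re ^ 2) / 2) := by
  have hint : Integrable fun x : EuclideanSpace ℝ (Fin d) =>
      C * (Real.exp (-(a * ‖x‖ ^ 2 / 2)) * ‖bargmannKernelMulti x z‖) := by
    simp only [gaussian_mul_norm_bargmannKernelMulti]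
    exact (integrable_euclideanSpace_prod fun i =>
      integrable_gaussian_mul_norm_bargmannKernel ha (z i)).const_mul C
  refine (norm_integral_le_of_norm_le hint ?_).trans_eq ?_
  · filter_upwards [hh] with x hx
    rw [norm_mul, ← mul_assoc]
    gcongr
  · rw [integral_const_mul]
    simp only [gaussian_mul_norm_bargmannKernelMulti]
    rw [integral_euclideanSpace_prod
      (fun i t => Real.exp (-(a * t ^ 2 / 2)) * ‖bargmannKernel t (z i)‖)]
    simp only [integral_gaussian_mul_norm_bargmannKernel ha hq]
    rw [Finset.prod_mul_distrib, ← Real.exp_sum, ← Finset.sum_div, Finset.sum_add_distrib,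
      ← Finset.mul_sum]
    simp [mul_assoc]

/-- The Fourier transform acts on the Bargmann transform as the rotation `z ↦ -iz`. -/
lemma bargmann_unitaryFourier {d : ℕ} {f : EuclideanSpace ℝ (Fin d) → ℂ} (hf : Integrable f)
    (z : Fin d → ℂ) :
    bargmann (unitaryFourier d f) z = bargmann f fun i => -Complex.I * z i := by
  have hker : Integrable fun ξ : EuclideanSpace ℝ (Fin d) => bargmannKernelMulti ξ z :=
    integrable_euclideanSpace_prod fun i => integrable_bargmannKernel (z i)
  have hgauss : ∀ x : EuclideanSpace ℝ (Fin d),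
      ∫ ξ : EuclideanSpace ℝ (Fin d), Complex.exp (-(Complex.I * ((inner ℝ ξ x : ℝ) : ℂ))) *
        bargmannKernelMulti ξ z =
      (√(2 * Real.pi) : ℝ) ^ d * bargmannKernelMulti x fun i => -Complex.I * z i := by
    intro x
    have h1 : ∀ ξ : EuclideanSpace ℝ (Fin d),
        Complex.exp (-(Complex.I * ((inner ℝ ξ x : ℝ) : ℂ))) * bargmannKernelMulti ξ z =
        ∏ i, (Complex.exp (-(Complex.I * ((ξ i * x i : ℝ) : ℂ))) * bargmannKernel (ξ i) (z i)) := by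
      intro ξ
      rw [bargmannKernelMulti, Finset.prod_mul_distrib, ← Complex.exp_sum, PiLp.inner_apply]
      congr 2
      simp [Finset.mul_sum, mul_comm]
    simp only [h1]
    rw [integral_euclideanSpace_prod (fun i t =>
      Complex.exp (-(Complex.I * ((t * x i : ℝ) : ℂ))) * bargmannKernel t (z i))]
    simp only [integral_fourier_bargmannKernel]
    rw [Finset.prod_mul_distrib, bargmannKernelMulti]
    simp
  have hconst : (((2 * Real.pi) ^ (-(d : ℝ) / 2) : ℝ) : ℂ) * (√(2 * Real.pi) : ℝ) ^ d = 1 := by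
    rw [← Complex.ofReal_pow, ← Complex.ofReal_mul, Real.sqrt_eq_rpow, ← Real.rpow_natCast,
      ← Real.rpow_mul Real.two_pi_pos.le, ← Real.rpow_add Real.two_pi_pos]
    rw [show -(d : ℝ) / 2 + 1 / 2 * d = 0 by ring]
    simp
  calc bargmann (unitaryFourier d f) z
      = (((2 * Real.pi) ^ (-(d : ℝ) / 2) : ℝ) : ℂ) * ∫ ξ : EuclideanSpace ℝ (Fin d),
          ∫ x : EuclideanSpace ℝ (Fin d), Complex.exp (-(Complex.I * ((inner ℝ ξ x : ℝ) : ℂ))) *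
            (bargmannKernelMulti ξ z * f x) := by
        rw [bargmann, ← integral_const_mul]
        congr 1
        ext ξ
        rw [unitaryFourier, mul_assoc, ← integral_mul_const]
        congr 2
        ext x
        ring
    _ = (((2 * Real.pi) ^ (-(d : ℝ) / 2) : ℝ) : ℂ) * ∫ x : EuclideanSpace ℝ (Fin d),
          ∫ ξ : EuclideanSpace ℝ (Fin d), Complex.exp (-(Complex.I * ((inner ℝ ξ x : ℝ) : ℂ))) *
            (bargmannKernelMulti ξ z * f x) := by
        congr 1
        apply integral_integral_swap
        refine (hker.mul_prod hf).bdd_mul (c := 1) (Continuous.aestronglyMeasurable (by fun_prop))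
          (Eventually.of_forall fun p => ?_)
        rw [Complex.norm_exp]
        simp
    _ = (((2 * Real.pi) ^ (-(d : ℝ) / 2) : ℝ) : ℂ) * ∫ x : EuclideanSpace ℝ (Fin d),
          (√(2 * Real.pi) : ℝ) ^ d * (f x * bargmannKernelMulti x fun i => -Complex.I * z i) := by
        congr 2
        ext x
        simp only [← mul_assoc]
        rw [integral_mul_const, hgauss]
        ring
    _ = _ := by
        rw [integral_const_mul, ← mul_assoc, hconst, one_mul, bargmann]

/-! ### Holomorphy and homogeneous components -/

section Regularity

variable {d : ℕ} {f : EuclideanSpace ℝ (Fin d) → ℂ}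

lemma norm_bargmann_le_of_norm_le (hf : Integrable f) {z : Fin d → ℂ} {R : ℝ} (hz : ‖z‖ ≤ R) :
    ‖bargmann f z‖ ≤ (∫ x, ‖f x‖) * Real.exp (d * (R ^ 2 / 2)) := by
  rw [← integral_mul_const]
  refine norm_integral_le_of_norm_le (hf.norm.mul_const _) (Eventually.of_forall fun x => ?_)
  rw [norm_mul]
  gcongr
  exact norm_bargmannKernelMulti_le x hz

lemma aestronglyMeasurable_mul_bargmannKernelMulti (hf : Integrable f) (z : Fin d → ℂ) :
    AEStronglyMeasurable (fun x => f x * bargmannKernelMulti x z) volume :=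
  hf.aestronglyMeasurable.mul (Continuous.aestronglyMeasurable (by fun_prop))

lemma continuous_bargmann (hf : Integrable f) : Continuous (bargmann f) := by
  rw [continuous_iff_continuousAt]
  intro z₀
  refine continuousAt_of_dominated (bound := fun x => ‖f x‖ *
      Real.exp (d * ((‖z₀‖ + 1) ^ 2 / 2)))
    (Eventually.of_forall fun z => aestronglyMeasurable_mul_bargmannKernelMulti hf z) ?_
    (hf.norm.mul_const _) (Eventually.of_forall fun x => ?_)
  · filter_upwards [Metric.ball_mem_nhds z₀ one_pos] with z hz
    refine Eventually.of_forall fun x => ?_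
    rw [norm_mul]
    gcongr
    refine norm_bargmannKernelMulti_le x ?_
    have : ‖z - z₀‖ < 1 := by simpa [dist_eq_norm] using hz
    linarith [norm_le_norm_add_norm_sub' z z₀]
  · exact Continuous.continuousAt (by fun_prop)

lemma norm_add_smul_le (a b : Fin d → ℂ) (t : ℂ) : ‖a + t • b‖ ≤ ‖a‖ + ‖t‖ * ‖b‖ :=
  (norm_add_le _ _).trans_eq (by rw [norm_smul])

lemma differentiable_bargmann_line (hf : Integrable f) (a b : Fin d → ℂ) :
    Differentiable ℂ fun t : ℂ => bargmann f (a + t • b) := by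
  refine differentiable_integral_of_dominated
    (F := fun t x => f x * bargmannKernelMulti x (a + t • b)) (fun x => ?_)
    (fun t => aestronglyMeasurable_mul_bargmannKernelMulti hf _) fun R =>
      ⟨fun x => ‖f x‖ * Real.exp (d * ((‖a‖ + R * ‖b‖) ^ 2 / 2)), hf.norm.mul_const _,
        fun x t ht => ?_⟩
  · refine (differentiable_const _).mul ?_
    unfold bargmannKernelMulti
    refine Differentiable.fun_finsetProd fun i _ => ?_
    exact (differentiable_bargmannKernel (x i)).comp
      (by simp only [Pi.add_apply, Pi.smul_apply]; fun_prop)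
  · rw [norm_mul]
    refine mul_le_mul_of_nonneg_left (norm_bargmannKernelMulti_le x
      ((norm_add_smul_le a b t).trans ?_)) (norm_nonneg _)
    gcongr

lemma differentiable_bargmann_smul (hf : Integrable f) (z : Fin d → ℂ) :
    Differentiable ℂ fun w : ℂ => bargmann f (w • z) := by
  simpa using differentiable_bargmann_line hf 0 z

/-- The homogeneous component of degree `k` of the Bargmann transform. -/
def bargmannComponent (f : EuclideanSpace ℝ (Fin d) → ℂ) (k : ℕ) (z : Fin d → ℂ) : ℂ :=
  taylorCoeff k fun w => bargmann f (w • z)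

lemma bargmannComponent_smul (hf : Integrable f) (k : ℕ) (c : ℂ) (z : Fin d → ℂ) :
    bargmannComponent f k (c • z) = c ^ k * bargmannComponent f k z := by
  unfold bargmannComponent
  rw [← taylorCoeff_comp_const_mul k (differentiable_bargmann_smul hf z) c]
  congr 1
  ext w
  rw [smul_smul, mul_comm]

lemma bargmannComponent_eq_integral (hf : Integrable f) (k : ℕ) (z : Fin d → ℂ) :
    bargmannComponent f k z =
      ∫ s : UnitAddCircle, (unitChar s ^ k)⁻¹ * bargmann f (unitChar s • z) :=
  (integral_unitChar_eq_taylorCoeff k (differentiable_bargmann_smul hf z)).symm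

/-- A crude bound, by Cauchy on the unit ball and homogeneity. It supplies the a priori polynomial
growth for Phragmén–Lindelöf. -/
lemma norm_bargmannComponent_le (hf : Integrable f) (k : ℕ) (z : Fin d → ℂ) :
    ‖bargmannComponent f k z‖ ≤ (∫ x, ‖f x‖) * Real.exp (d * (1 ^ 2 / 2)) * ‖z‖ ^ k := by
  have key : ∀ z : Fin d → ℂ, ‖z‖ ≤ 1 →
      ‖bargmannComponent f k z‖ ≤ (∫ x, ‖f x‖) * Real.exp (d * (1 ^ 2 / 2)) := by
    intro z hz
    refine norm_taylorCoeff_le k (differentiable_bargmann_smul hf z) fun w hw => ?_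
    exact norm_bargmann_le_of_norm_le hf (by rw [norm_smul, hw, one_mul]; exact hz)
  rcases eq_or_ne z 0 with rfl | hz
  · rcases eq_or_ne k 0 with rfl | hk
    · simpa using key 0 (by simp)
    · have := bargmannComponent_smul hf k 0 0
      rw [smul_zero, zero_pow hk, zero_mul] at this
      rw [this, norm_zero]
      positivity
  · have hz' : (0 : ℝ) < ‖z‖ := norm_pos_iff.2 hz
    have h1 : z = (‖z‖ : ℂ) • ((‖z‖ : ℂ)⁻¹ • z) := by
      rw [smul_smul, mul_inv_cancel₀ (by exact_mod_cast hz'.ne'), one_smul]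
    have h2 : ‖((‖z‖ : ℂ)⁻¹ • z)‖ ≤ 1 := by
      rw [norm_smul, norm_inv, Complex.norm_real, norm_norm, inv_mul_cancel₀ hz'.ne']
    conv_lhs => rw [h1]
    rw [bargmannComponent_smul hf, norm_mul, norm_pow, Complex.norm_real, norm_norm, mul_comm]
    gcongr
    exact key _ h2

lemma differentiable_bargmannComponent_line (hf : Integrable f) (k : ℕ) (a b : Fin d → ℂ) :
    Differentiable ℂ fun t : ℂ => bargmannComponent f k (a + t • b) := by
  simp only [bargmannComponent_eq_integral hf]
  refine differentiable_integral_of_dominated (fun s => ?_) (fun t => ?_) fun R =>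
    ⟨fun _ => (∫ x, ‖f x‖) * Real.exp (d * ((‖a‖ + R * ‖b‖) ^ 2 / 2)), integrable_const _,
      fun s t ht => ?_⟩
  · refine (differentiable_const _).mul ?_
    have := differentiable_bargmann_line hf (unitChar s • a) (unitChar s • b)
    simpa only [smul_add, smul_comm _ (unitChar s)] using this
  · have hc := continuous_bargmann hf
    refine Continuous.aestronglyMeasurable ?_
    have h1 : Continuous fun s => (unitChar s ^ k)⁻¹ :=
      (continuous_unitChar.pow k).inv₀ fun s => pow_ne_zero _ (unitChar_ne_zero s)
    exact h1.mul (hc.comp (by fun_prop))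
  · rw [norm_mul, norm_inv, norm_pow, norm_unitChar, one_pow, inv_one, one_mul]
    refine norm_bargmann_le_of_norm_le hf ?_
    rw [norm_smul, norm_unitChar, one_mul]
    refine (norm_add_smul_le a b t).trans ?_
    gcongr

/-- A bound for the homogeneous component on real vectors extends to complex vectors. -/
lemma norm_bargmannComponent_le_of_real (hf : Integrable f) {k : ℕ} {M : ℝ} (hM : 0 ≤ M)
    (h : ∀ u : EuclideanSpace ℝ (Fin d), ‖bargmannComponent f k fun i => (u i : ℂ)‖ ≤ M * ‖u‖ ^ k)
    (x y : EuclideanSpace ℝ (Fin d)) :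
    ‖bargmannComponent f k fun i => (x i : ℂ) + Complex.I * y i‖ ≤ M * (‖x‖ + ‖y‖) ^ k := by
  have hsup : ∀ v : EuclideanSpace ℝ (Fin d), ‖(fun i => (v i : ℂ))‖ ≤ ‖v‖ := fun v => by
    rw [pi_norm_le_iff_of_nonneg (norm_nonneg _)]
    intro i
    rw [Complex.norm_real]
    exact PiLp.norm_apply_le v i
  have hB : 0 ≤ (∫ x, ‖f x‖) * Real.exp (d * (1 ^ 2 / 2)) := by positivity
  have := norm_apply_I_le_add_pow
    (differentiable_bargmannComponent_line hf k (fun i => (x i : ℂ)) fun i => (y i : ℂ))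
    (X := ‖x‖) (Y := ‖y‖) (m := inner ℝ x y) (k := k) (norm_nonneg x) (norm_nonneg y)
    (abs_real_inner_le_norm x y) hM hB (fun t => ?_) (fun t => ?_)
  · exact this
  · refine le_trans (le_of_eq ?_) ((h (x + t • y)).trans_eq ?_)
    · congr 2
      ext i
      simp
    · congr 2
      rw [← Real.sqrt_sq (norm_nonneg _), norm_add_sq_real, norm_smul, real_inner_smul_right,
        mul_pow, Real.norm_eq_abs, sq_abs]
      congr 1
      ring
  · refine (norm_bargmannComponent_le hf k _).trans ?_
    gcongr
    refine (norm_add_smul_le _ _ t).trans ?_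
    gcongr
    · exact hsup x
    · exact hsup y

/-- On the unit torus the homogeneous component is controlled by its values on the real sphere. -/
lemma norm_bargmannComponent_le_of_norm_eq_one (hf : Integrable f) (hd : 1 ≤ d) {k : ℕ} {M : ℝ}
    (hM : 0 ≤ M)
    (h : ∀ u : EuclideanSpace ℝ (Fin d), ‖bargmannComponent f k fun i => (u i : ℂ)‖ ≤ M * ‖u‖ ^ k)
    {z : Fin d → ℂ} (hz : ∀ i, ‖z i‖ = 1) :
    ‖bargmannComponent f k z‖ ≤ M * d ^ k := by
  -- For `d = 1` one has `√(2d) > d`; instead `z` is a unimodular multiple of a real vector.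
  rcases hd.eq_or_lt with rfl | hd2
  · have h1 : z = z 0 • fun i => ((WithLp.toLp 2 (fun _ => (1 : ℝ)) :
        EuclideanSpace ℝ (Fin 1)) i : ℂ) := by
      ext i
      rw [Subsingleton.elim i 0]
      simp
    rw [h1, bargmannComponent_smul hf, norm_mul, norm_pow, hz, one_pow, one_mul]
    refine (h _).trans_eq ?_
    simp [EuclideanSpace.norm_eq]
  · set x : EuclideanSpace ℝ (Fin d) := WithLp.toLp 2 fun i => (z i).re
    set y : EuclideanSpace ℝ (Fin d) := WithLp.toLp 2 fun i => (z i).im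
    have h1 : z = fun i => (x i : ℂ) + Complex.I * y i := by
      ext i
      rw [mul_comm]
      exact (Complex.re_add_im (z i)).symm
    rw [h1]
    refine (norm_bargmannComponent_le_of_real hf hM h x y).trans ?_
    gcongr
    have h2 : ‖x‖ ^ 2 + ‖y‖ ^ 2 = d := by
      rw [EuclideanSpace.real_norm_sq_eq, EuclideanSpace.real_norm_sq_eq, ← Finset.sum_add_distrib]
      have : ∀ i, x i ^ 2 + y i ^ 2 = 1 := fun i => by
        have := hz i
        rw [Complex.norm_eq_sqrt_sq_add_sq, Real.sqrt_eq_one] at this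
        exact this
      simp [this]
    have h3 : (2 : ℝ) ≤ d := by exact_mod_cast hd2
    refine (pow_le_pow_iff_left₀ (by positivity) (by positivity) two_ne_zero).1 ?_
    -- Here `(‖x‖+‖y‖)² ≤ 2(‖x‖²+‖y‖²) = 2d ≤ d²`.
    nlinarith [sq_nonneg (‖x‖ - ‖y‖)]

end Regularity

/-! ### Growth for the Hardy class -/

lemma HardyBound.nonneg {d : ℕ} {a C : ℝ} {f : EuclideanSpace ℝ (Fin d) → ℂ}
    (h : HardyBound d a C f) : 0 ≤ C := by
  simpa using (norm_nonneg _).trans (h.fourier_bound 0)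

/-- Along complex lines through real unit vectors, the Bargmann transform of a function in the
Hardy class has Gaussian growth in both directions. -/
lemma HardyBound.hasHardyGrowth {d : ℕ} {a q C : ℝ} {f : EuclideanSpace ℝ (Fin d) → ℂ}
    (h : HardyBound d a C f) (hf : Integrable f) (ha : -1 < a) (hq : q * (1 + a) = 1 - a)
    {u : EuclideanSpace ℝ (Fin d)} (hu : ‖u‖ = 1) :
    HasHardyGrowth q (C * √(2 * Real.pi / (1 + a)) ^ d)
      fun w => bargmann f (w • fun i => (u i : ℂ)) := by
  have hsum : ∑ i, u i ^ 2 = 1 := by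
    rw [← EuclideanSpace.real_norm_sq_eq, hu, one_pow]
  have hre : ∀ w : ℂ, ∑ i, ((w • fun i => (u i : ℂ)) i).re ^ 2 = w.re ^ 2 := fun w => by
    simp [mul_pow, ← Finset.mul_sum, hsum]
  have him : ∀ w : ℂ, ∑ i, ((w • fun i => (u i : ℂ)) i).im ^ 2 = w.im ^ 2 := fun w => by
    simp [mul_pow, ← Finset.mul_sum, hsum]
  constructor
  · intro w
    have := norm_bargmann_le ha hq h.bound (w • fun i => (u i : ℂ))
    rwa [hre, him] at this
  · intro w
    -- Evaluating at `iw` undoes the rotation by `-i` and swaps real and imaginary parts in the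
    -- exponent.
    have h1 := norm_bargmann_le ha hq (Eventually.of_forall h.fourier_bound)
      ((Complex.I * w) • fun i => (u i : ℂ))
    rw [hre, him, bargmann_unitaryFourier hf] at h1
    have h2 : (fun i => -Complex.I * ((Complex.I * w) • fun i => (u i : ℂ)) i) =
        w • fun i => (u i : ℂ) := by
      ext i
      simp only [Pi.smul_apply, smul_eq_mul, ← mul_assoc]
      rw [neg_mul, Complex.I_mul_I]
      ring
    rw [h2] at h1
    simpa using h1

/-! ### Hermite functions as Taylor coefficients -/

lemma ofReal_iteratedDeriv_gaussian (k : ℕ) : ∀ x : ℝ,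
    ((iteratedDeriv k (fun t : ℝ => Real.exp (-t ^ 2)) x : ℝ) : ℂ) =
      iteratedDeriv k (fun z : ℂ => Complex.exp (-z ^ 2)) x := by
  have hsm : ContDiff ℂ ⊤ (fun z : ℂ => Complex.exp (-z ^ 2)) := by fun_prop
  have hsmr : ContDiff ℝ ⊤ (fun z : ℝ => Real.exp (-z ^ 2)) := by fun_prop
  induction k with
  | zero => intro x; simp
  | succ k ih =>
    intro x
    rw [iteratedDeriv_succ, iteratedDeriv_succ]
    have h1 : HasDerivAt (fun y : ℝ => iteratedDeriv k (fun z : ℂ => Complex.exp (-z ^ 2)) y)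
        (deriv (iteratedDeriv k fun z : ℂ => Complex.exp (-z ^ 2)) x) x :=
      ((hsm.differentiable_iteratedDeriv k (by simp)).differentiableAt.hasDerivAt).comp_ofReal
    have h2 : HasDerivAt (fun y : ℝ => iteratedDeriv k (fun t : ℝ => Real.exp (-t ^ 2)) y)
        (deriv (iteratedDeriv k fun t : ℝ => Real.exp (-t ^ 2)) x) x :=
      (hsmr.differentiable_iteratedDeriv k (by simp)).differentiableAt.hasDerivAt
    have h3 := h2.ofReal_comp
    simp only [ih] at h3
    exact h3.unique h1

/-- The Hermite functions are the normalised Taylor coefficients of the Bargmann kernel. -/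
lemma ofReal_hermiteFun (k : ℕ) (x : ℝ) :
    (hermiteFun k x : ℂ) = (((√(√Real.pi))⁻¹ * √(k.factorial : ℝ) : ℝ) : ℂ) *
      taylorCoeff k (bargmannKernel x) := by
  have hG : Differentiable ℂ fun z : ℂ => Complex.exp (-z ^ 2) := by fun_prop
  have hGx : Differentiable ℂ fun z : ℂ => Complex.exp (-((x : ℂ) + z) ^ 2) := by fun_prop
  have h2 : ((√2 : ℝ) : ℂ) ^ 2 = 2 := by
    rw [← Complex.ofReal_pow, Real.sq_sqrt (by norm_num)]; norm_num
  have h20 : ((√2 : ℝ) : ℂ) ≠ 0 := by simp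
  -- The exponent is `x²/2 - (x - z/√2)²`, so expanding in `z` expands the Gaussian about `x`.
  have hk : bargmannKernel x = fun z => Complex.exp ((x : ℂ) ^ 2 / 2) *
      Complex.exp (-((x : ℂ) + -((√2 : ℝ) : ℂ)⁻¹ * z) ^ 2) := by
    ext z
    rw [bargmannKernel, ← Complex.exp_add]
    congr 1
    field_simp
    rw [h2]
    ring_nf
    rw [h2]
    ring
  have hshift : iteratedDeriv k (fun z : ℂ => Complex.exp (-((x : ℂ) + z) ^ 2)) 0 =
      iteratedDeriv k (fun z : ℂ => Complex.exp (-z ^ 2)) x := by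
    rw [iteratedDeriv_comp_const_add k (fun z : ℂ => Complex.exp (-z ^ 2)) (x : ℂ)]
    simp
  have ht : taylorCoeff k (bargmannKernel x) = Complex.exp ((x : ℂ) ^ 2 / 2) *
      ((-((√2 : ℝ) : ℂ)⁻¹) ^ k * iteratedDeriv k (fun z : ℂ => Complex.exp (-z ^ 2)) x) /
        (k.factorial : ℂ) := by
    rw [taylorCoeff, hk, iteratedDeriv_const_mul_field,
      iteratedDeriv_comp_const_mul hGx.contDiff (-((√2 : ℝ) : ℂ)⁻¹)]
    simp only [mul_zero]
    rw [hshift]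
  rw [ht, ← ofReal_iteratedDeriv_gaussian, hermiteFun]
  have e1 : Complex.exp ((x : ℂ) ^ 2 / 2) = ((Real.exp (x ^ 2 / 2) : ℝ) : ℂ) := by push_cast; rfl
  have e2 : (-((√2 : ℝ) : ℂ)⁻¹) ^ k = (((-1) ^ k * (√2 ^ k)⁻¹ : ℝ) : ℂ) := by
    rw [neg_pow]; push_cast; rw [inv_pow]
  rw [e1, e2]
  simp only [← Complex.ofReal_natCast, ← Complex.ofReal_mul, ← Complex.ofReal_div]
  congr 1
  have hf0 : (0 : ℝ) < k.factorial := by exact_mod_cast k.factorial_pos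
  have hpi : 0 < √(√Real.pi) := Real.sqrt_pos.2 (Real.sqrt_pos.2 Real.pi_pos)
  rw [Real.sqrt_mul (by positivity), Real.sqrt_mul (by positivity)]
  have e3 : √((2 : ℝ) ^ k) = √2 ^ k := by
    rw [Real.sqrt_eq_iff_mul_self_eq (by positivity) (by positivity), ← mul_pow,
      Real.mul_self_sqrt (by norm_num)]
  rw [e3]
  have hs : √(k.factorial : ℝ) * √(k.factorial : ℝ) = k.factorial := Real.mul_self_sqrt hf0.le
  have hs0 : 0 < √(k.factorial : ℝ) := Real.sqrt_pos.2 hf0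
  have e4 : (√(k.factorial : ℝ))⁻¹ = √(k.factorial : ℝ) / k.factorial := by
    field_simp; rw [sq, hs]
  rw [mul_inv, mul_inv, e4]
  field_simp

/-! ### Hermite coefficients as torus integrals -/

section Torus

variable {d : ℕ}

/-- The torus embedded in `ℂ^d`. -/
def torusPoint (t : Fin d → UnitAddCircle) : Fin d → ℂ := fun i => unitChar (t i)

/-- The inverse of the monomial of exponent `α` on the torus. -/
def torusWeight (α : Fin d → ℕ) (t : Fin d → UnitAddCircle) : ℂ := ∏ i, (unitChar (t i) ^ α i)⁻¹

@[fun_prop]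
lemma continuous_torusPoint : Continuous (torusPoint (d := d)) := by
  unfold torusPoint; fun_prop

@[fun_prop]
lemma continuous_torusWeight (α : Fin d → ℕ) : Continuous (torusWeight α) := by
  refine continuous_finsetProd _ fun i _ => ?_
  exact ((continuous_unitChar.comp (continuous_apply i)).pow _).inv₀
    fun s => pow_ne_zero _ (unitChar_ne_zero _)

lemma norm_torusWeight (α : Fin d → ℕ) (t : Fin d → UnitAddCircle) : ‖torusWeight α t‖ = 1 := by
  simp [torusWeight, norm_unitChar]

lemma norm_torusPoint_le (t : Fin d → UnitAddCircle) : ‖torusPoint t‖ ≤ 1 := by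
  rw [pi_norm_le_iff_of_nonneg zero_le_one]
  exact fun i => (norm_unitChar _).le

lemma torusPoint_add_const (t : Fin d → UnitAddCircle) (s : UnitAddCircle) :
    torusPoint (t + fun _ => s) = unitChar s • torusPoint t := by
  ext i
  simp [torusPoint, unitChar_add, mul_comm]

lemma torusWeight_add_const (α : Fin d → ℕ) (t : Fin d → UnitAddCircle) (s : UnitAddCircle) :
    torusWeight α (t + fun _ => s) = torusWeight α t * (unitChar s ^ ∑ i, α i)⁻¹ := by
  simp [torusWeight, unitChar_add, mul_pow, Finset.prod_mul_distrib, Finset.prod_inv_distrib,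
    Finset.prod_pow_eq_pow_sum, mul_comm]

lemma measureReal_univ_unitAddCircle : (volume : Measure UnitAddCircle).real univ = 1 := by
  simp [Measure.real]

lemma measureReal_univ_torus : (volume : Measure (Fin d → UnitAddCircle)).real univ = 1 := by
  rw [Measure.real, volume_pi, Measure.pi_univ]
  simp

lemma ofReal_hermiteFunMulti (α : Fin d → ℕ) (x : EuclideanSpace ℝ (Fin d)) :
    (hermiteFunMulti α x : ℂ) =
      (((√(√Real.pi))⁻¹ ^ d * ∏ i, √((α i).factorial : ℝ) : ℝ) : ℂ) *
        ∫ t : Fin d → UnitAddCircle, torusWeight α t * bargmannKernelMulti x (torusPoint t) := by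
  have h : ∀ t : Fin d → UnitAddCircle,
      torusWeight α t * bargmannKernelMulti x (torusPoint t) =
        ∏ i, ((unitChar (t i) ^ α i)⁻¹ * bargmannKernel (x i) (unitChar (t i))) := fun t => by
    rw [torusWeight, bargmannKernelMulti, Finset.prod_mul_distrib]; rfl
  simp only [h]
  rw [integral_fintype_prod_volume_eq_prod
    (fun i (s : UnitAddCircle) => (unitChar s ^ α i)⁻¹ * bargmannKernel (x i) (unitChar s))]
  simp only [integral_unitChar_eq_taylorCoeff _ (differentiable_bargmannKernel _)]
  rw [hermiteFunMulti, Complex.ofReal_prod]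
  simp only [ofReal_hermiteFun]
  rw [Finset.prod_mul_distrib]
  congr 1
  push_cast
  rw [Finset.prod_mul_distrib]
  simp

variable {f : EuclideanSpace ℝ (Fin d) → ℂ}

lemma hermiteCoeff_eq_integral_torus (hf : Integrable f) (α : Fin d → ℕ) :
    hermiteCoeff f α = (((√(√Real.pi))⁻¹ ^ d * ∏ i, √((α i).factorial : ℝ) : ℝ) : ℂ) *
      ∫ t : Fin d → UnitAddCircle, torusWeight α t * bargmann f (torusPoint t) := by
  have hswap : ∫ x : EuclideanSpace ℝ (Fin d), ∫ t : Fin d → UnitAddCircle,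
      torusWeight α t * bargmannKernelMulti x (torusPoint t) * f x =
      ∫ t : Fin d → UnitAddCircle, ∫ x : EuclideanSpace ℝ (Fin d),
        torusWeight α t * bargmannKernelMulti x (torusPoint t) * f x := by
    apply integral_integral_swap
    have h1 : Integrable (fun p : EuclideanSpace ℝ (Fin d) × (Fin d → UnitAddCircle) => f p.1)
        (volume.prod volume) := hf.comp_fst _
    refine h1.bdd_mul (c := Real.exp (d * (1 ^ 2 / 2)))
      (Continuous.aestronglyMeasurable (by fun_prop)) (Eventually.of_forall fun p => ?_)
    rw [norm_mul, norm_torusWeight, one_mul]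
    exact norm_bargmannKernelMulti_le _ (norm_torusPoint_le _)
  calc hermiteCoeff f α
      = ∫ x : EuclideanSpace ℝ (Fin d),
          (((√(√Real.pi))⁻¹ ^ d * ∏ i, √((α i).factorial : ℝ) : ℝ) : ℂ) *
          ∫ t : Fin d → UnitAddCircle,
            torusWeight α t * bargmannKernelMulti x (torusPoint t) * f x := by
        rw [hermiteCoeff]
        congr 1
        ext x
        rw [ofReal_hermiteFunMulti, integral_mul_const]
        ring
    _ = _ := by
        rw [integral_const_mul, hswap]
        congr 2
        ext t
        rw [bargmann, ← integral_const_mul]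
        congr 1
        ext x
        ring

/-- Averaging over the diagonal circle isolates the homogeneous component. -/
lemma integral_torus_eq_component (hf : Integrable f) (α : Fin d → ℕ) :
    ∫ t : Fin d → UnitAddCircle, torusWeight α t * bargmann f (torusPoint t) =
      ∫ t : Fin d → UnitAddCircle,
        torusWeight α t * bargmannComponent f (∑ i, α i) (torusPoint t) := by
  have hc := continuous_bargmann hf
  set H : (Fin d → UnitAddCircle) → ℂ := fun t => torusWeight α t * bargmann f (torusPoint t)
    with hH
  have hHc : Continuous H := by
    rw [hH]; exact (continuous_torusWeight α).mul (hc.comp continuous_torusPoint)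
  calc ∫ t, H t = ∫ _s : UnitAddCircle, ∫ t, H t := by
        rw [integral_const, measureReal_univ_unitAddCircle, one_smul]
    -- Diagonal translations preserve the torus measure; after Fubini the integral over `s` is
    -- Cauchy's formula for the component.
    _ = ∫ s : UnitAddCircle, ∫ t, H (t + fun _ => s) := by
        congr 1
        ext s
        exact (integral_add_right_eq_self H _).symm
    _ = ∫ t, ∫ s : UnitAddCircle, H (t + fun _ => s) := by
        apply integral_integral_swap
        exact (hHc.comp (by fun_prop : Continuous fun p : UnitAddCircle × (Fin d → UnitAddCircle) =>
          p.2 + fun _ => p.1)).integrable_of_hasCompactSupport (HasCompactSupport.of_compactSpace _)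
    _ = _ := by
        congr 1
        ext t
        rw [bargmannComponent_eq_integral hf, ← integral_const_mul]
        congr 1
        ext s
        rw [hH]
        simp only [torusPoint_add_const, torusWeight_add_const, mul_assoc]

lemma norm_hermiteCoeff_le (hf : Integrable f) (hd : 1 ≤ d) (α : Fin d → ℕ) {M : ℝ} (hM : 0 ≤ M)
    (h : ∀ u : EuclideanSpace ℝ (Fin d),
      ‖bargmannComponent f (∑ i, α i) fun i => (u i : ℂ)‖ ≤ M * ‖u‖ ^ (∑ i, α i)) :
    ‖hermiteCoeff f α‖ ≤ (√(√Real.pi))⁻¹ ^ d * √((∑ i, α i).factorial : ℝ) *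
      (M * d ^ (∑ i, α i)) := by
  rw [hermiteCoeff_eq_integral_torus hf, integral_torus_eq_component hf, norm_mul,
    Complex.norm_real, Real.norm_of_nonneg (by positivity)]
  gcongr
  -- `∏ αᵢ!` divides `|α|!`.
  · rw [← Real.sqrt_prod _ fun i _ => by positivity]
    apply Real.sqrt_le_sqrt
    exact_mod_cast Nat.le_of_dvd (Nat.factorial_pos _) (Nat.prod_factorial_dvd_factorial_sum _ _)
  · have := norm_integral_le_of_norm_le_const (μ := (volume : Measure (Fin d → UnitAddCircle)))
      (f := fun t => torusWeight α t * bargmannComponent f (∑ i, α i) (torusPoint t))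
      (C := M * d ^ (∑ i, α i)) (Eventually.of_forall fun t => by
        rw [norm_mul, norm_torusWeight, one_mul]
        exact norm_bargmannComponent_le_of_norm_eq_one hf hd hM h fun i => norm_unitChar _)
    rwa [measureReal_univ_torus, mul_one] at this

end Torus

/-! ### Stirling's bound and the conclusion -/

lemma factorial_le_stirling {k : ℕ} (hk : k ≠ 0) :
    (k.factorial : ℝ) ≤ Real.exp 1 * √k * (k / Real.exp 1) ^ k := by
  obtain ⟨n, rfl⟩ := Nat.exists_eq_succ_of_ne_zero hk
  -- The Stirling sequence decreases from its value `e/√2` at `1`.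
  have h := Stirling.stirlingSeq'_antitone (Nat.zero_le n)
  simp only [Function.comp, Nat.succ_eq_add_one, zero_add, Stirling.stirlingSeq_one] at h
  rw [Stirling.stirlingSeq, div_le_iff₀ (by positivity)] at h
  refine h.trans_eq ?_
  rw [Real.sqrt_mul (by norm_num)]
  field_simp

lemma sqrt_factorial_le {k : ℕ} (hk : k ≠ 0) :
    √(k.factorial : ℝ) ≤
      √(Real.exp 1) * (k : ℝ) ^ (1 / 4 : ℝ) * (√k ^ k / Real.exp (k / 2)) := by
  have hk0 : (0 : ℝ) < k := by exact_mod_cast Nat.pos_of_ne_zero hk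
  rw [Real.sqrt_le_left (by positivity)]
  refine (factorial_le_stirling hk).trans_eq ?_
  rw [mul_pow, mul_pow, Real.sq_sqrt (Real.exp_pos 1).le, div_pow, div_pow, ← Real.exp_nat_mul,
    ← Real.exp_nat_mul, ← pow_mul, mul_comm k 2, pow_mul, Real.sq_sqrt hk0.le, ← Real.rpow_natCast
    ((k : ℝ) ^ (1 / 4 : ℝ)), ← Real.rpow_mul hk0.le, Real.sqrt_eq_rpow]
  norm_num
  ring_nf
  simp

end

theorem theorem3p4 (d : ℕ) (hd : 1 ≤ d) (γ : ℝ) (hγ : 0 < γ) :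
    ∃ K : ℝ, 0 < K ∧
      ∀ f ∈ hardyClass d (Real.tanh (2 * γ)),
        ∀ C : ℝ, HardyBound d (Real.tanh (2 * γ)) C f →
          ∀ α : Fin d → ℕ, α ≠ 0 →
            ‖hermiteCoeff f α‖ ≤
              K * C * ((d : ℝ) ^ (∑ i, α i) *
                ((∑ i, α i : ℕ) : ℝ) ^ (((d : ℝ) - 2) / 4) *
                Real.exp (-(γ * ((∑ i, α i : ℕ) : ℝ)))) := by
  set a := Real.tanh (2 * γ) with ha
  set B := Real.exp (-γ) with hB
  have hB0 : 0 < B := Real.exp_pos _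
  have hB1 : B < 1 := Real.exp_zero ▸ Real.exp_lt_exp.2 (by linarith)
  have ha1 : -1 < a := Real.neg_one_lt_tanh _
  -- With `B = e^{-γ}`, `A = B²` and `q = A² = e^{-4γ}`.
  have hq : (B ^ 2) ^ 2 * (1 + a) = 1 - a := by
    have h1 : Real.exp (2 * γ) = (B ^ 2)⁻¹ := by
      rw [hB, ← Real.exp_nat_mul, ← Real.exp_neg]; congr 1; push_cast; ring
    have h2 : Real.exp (-(2 * γ)) = B ^ 2 := by rw [Real.exp_neg, h1, inv_inv]
    rw [ha, Real.tanh_eq, h1, h2]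
    field_simp
    ring
  obtain ⟨K₀, hK₀, hK⟩ := norm_taylorCoeff_le_of_hardyGrowth hB0 hB1
  have h1a : 0 < 1 + a := by linarith
  set κ := √(2 * Real.pi / (1 + a)) ^ d with hκ
  have hκ0 : 0 < κ := by have := Real.pi_pos; positivity
  have hpi : 0 < √(√Real.pi) := Real.sqrt_pos.2 (Real.sqrt_pos.2 Real.pi_pos)
  refine ⟨(√(√Real.pi))⁻¹ ^ d * √(Real.exp 1) * K₀ * κ, by positivity, ?_⟩
  rintro f ⟨hf1, -, -⟩ C hC α hα
  have hf : Integrable f := memLp_one_iff_integrable.1 hf1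
  have hC0 := hC.nonneg
  set k := ∑ i, α i with hk
  have hk0 : k ≠ 0 := by
    intro h
    apply hα
    ext i
    exact (Finset.sum_eq_zero_iff.1 h) i (Finset.mem_univ i)
  have hkpos : (0 : ℝ) < k := by exact_mod_cast Nat.pos_of_ne_zero hk0
  have hk1 : (1 : ℝ) ≤ k := by exact_mod_cast Nat.one_le_iff_ne_zero.2 hk0
  set M := K₀ * (C * κ) * (B ^ k * Real.exp (k / 2) / (√k ^ k * √k)) with hM
  have hM0 : 0 ≤ M := by positivity
  have hreal : ∀ u : EuclideanSpace ℝ (Fin d),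
      ‖bargmannComponent f k fun i => (u i : ℂ)‖ ≤ M * ‖u‖ ^ k := by
    intro u
    rcases eq_or_ne u 0 with rfl | hu
    · have hz : (fun i => (((0 : EuclideanSpace ℝ (Fin d)) i : ℝ) : ℂ)) = 0 := by ext i; simp
      rw [hz]
      have := norm_bargmannComponent_le hf k 0
      simpa [hk0] using this
    · have hu0 : 0 < ‖u‖ := norm_pos_iff.2 hu
      set v : EuclideanSpace ℝ (Fin d) := ‖u‖⁻¹ • u with hv
      have hv1 : ‖v‖ = 1 := by
        rw [hv, norm_smul, norm_inv, norm_norm, inv_mul_cancel₀ hu0.ne']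
      have huv : (fun i => (u i : ℂ)) = (‖u‖ : ℂ) • fun i => (v i : ℂ) := by
        ext i
        have : (‖u‖ : ℂ) ≠ 0 := by exact_mod_cast hu0.ne'
        simp [hv, this]
      rw [huv, bargmannComponent_smul hf, norm_mul, norm_pow, Complex.norm_real, norm_norm,
        mul_comm]
      gcongr
      exact hK _ _ (differentiable_bargmann_smul hf _) (hC.hasHardyGrowth hf ha1 hq hv1) k hk0
  refine (norm_hermiteCoeff_le hf hd α hM0 hreal).trans ?_
  rw [← hk]
  have hBk : B ^ k = Real.exp (-(γ * k)) := by
    rw [hB, ← Real.exp_nat_mul]; congr 1; ring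
  have hd1 : (1 : ℝ) ≤ d := by exact_mod_cast hd
  have hsk : 0 < √(k : ℝ) := Real.sqrt_pos.2 hkpos
  -- The argument yields `k^{-1/4}`, which is `k^{(d-2)/4}` for `d = 1` and no larger for `d > 1`.
  have hpow : (k : ℝ) ^ (1 / 4 : ℝ) / √k ≤ (k : ℝ) ^ (((d : ℝ) - 2) / 4) := by
    rw [Real.sqrt_eq_rpow, ← Real.rpow_sub hkpos]
    exact Real.rpow_le_rpow_of_exponent_le hk1 (by linarith)
  calc (√(√Real.pi))⁻¹ ^ d * √(k.factorial : ℝ) * (M * d ^ k)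
      ≤ (√(√Real.pi))⁻¹ ^ d * (√(Real.exp 1) * (k : ℝ) ^ (1 / 4 : ℝ) *
          (√k ^ k / Real.exp (k / 2))) * (M * d ^ k) := by
        gcongr
        exact sqrt_factorial_le hk0
    _ = (√(√Real.pi))⁻¹ ^ d * √(Real.exp 1) * K₀ * κ * C *
          (d ^ k * ((k : ℝ) ^ (1 / 4 : ℝ) / √k) * B ^ k) := by
        rw [hM]
        have := Real.exp_pos ((k : ℝ) / 2)
        field_simp
    _ ≤ _ := by
        rw [hBk]
        gcongr
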